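/- In the Counting Orthogonal Vectors problem ($\#\mathsf{OV}$) one is given $n\ge 1$, $d\ge 0$ and vectors $u_1,\dots,u_n,v_1,\dots,v_n\in\{0,1\}^d$, and must output the number of pairs $(i,j)\in\{1,\dots,n\}^2$ with $\langle u_i,v_j\rangle=0$, where the inner product is taken over $\mathbb Z$. The problem $\#\mathsf{OV}$ can be solved deterministically in time $\tilde O(n\cdot 1.26^d)$. That is, there are a single deterministic random access machine program and constants $C,k$ such that, for all $n\ge 1$, all $d\ge 0$ and all inputs $u_1,\dots,u_n,v_1,\dots,v_n\in\{0,1\}^d$, the program halts with the correct count after time at most $$C\cdot n\cdot 1.26^d\cdot\bigl(1+\log(n\cdot 1.26^d)\bigr)^k .$$ Time is measured in the logarithmic cost model: registers and memory cells hold natural numbers, the instructions are loading a constant, addition, truncated subtraction, indirect read and write, and tests for zero, and each executed instruction costs one plus the total bit length of the numbers and memory addresses on which it operates. The input is given as $n$ and $d$ in two registers and the $2nd$ bits of the vectors in consecutive memory cells; all other registers and cells are initially $0$. -/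

import Mathlib

/-! ### A random access machine with logarithmic cost

The machine has registers `r₀, r₁, r₂, …` (a program names only finitely many of them) and a memory
with cells `0, 1, 2, …`; each register and each cell holds a natural number. The instruction set is
the classical one: load a constant, addition, (truncated) subtraction, indirect read, indirect
write, and control flow by testing a register for zero. Every executed instruction is charged one
unit plus the bit lengths of all the numbers and memory addresses on which it operates. -/

namespace RAM

/-- The contents of the registers and of the memory. -/
structure State where
  reg : ℕ → ℕ
  mem : ℕ → ℕ

/-- The state after writing `x` into register `i`. -/
def State.setReg (s : State) (i x : ℕ) : State :=
  ⟨Function.update s.reg i x, s.mem⟩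

/-- The state after writing `x` into memory cell `a`. -/
def State.setMem (s : State) (a x : ℕ) : State :=
  ⟨s.reg, Function.update s.mem a x⟩

/-- Programs. A program is a finite object; the numbers `i`, `j`, `k` (register names) and `c`
(constants) are fixed in the program text and so do not depend on the input. -/
inductive Program where
  /-- do nothing -/
  | skip : Program
  /-- `rᵢ := c` -/
  | const (i c : ℕ) : Program
  /-- `rᵢ := rⱼ + rₖ` -/
  | add (i j k : ℕ) : Program
  /-- `rᵢ := max (rⱼ - rₖ) 0` -/
  | sub (i j k : ℕ) : Program
  /-- `rᵢ := mem[rⱼ]` -/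
  | load (i j : ℕ) : Program
  /-- `mem[rᵢ] := rⱼ` -/
  | store (i j : ℕ) : Program
  /-- first `p`, then `q` -/
  | seq (p q : Program) : Program
  /-- if `rᵢ ≠ 0` then `p` else `q` -/
  | cond (i : ℕ) (p q : Program) : Program
  /-- while `rᵢ ≠ 0` do `p` -/
  | loop (i : ℕ) (p : Program) : Program

/-- `Runs p s s' t`: started in state `s`, the program `p` halts in state `s'`, and the total
(logarithmic) cost of the execution is `t`. `Nat.size x` is the bit length of `x`. -/
inductive Runs : Program → State → State → ℕ → Prop where
  | skip (s : State) : Runs .skip s s 1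
  | const (i c : ℕ) (s : State) : Runs (.const i c) s (s.setReg i c) (1 + c.size)
  | add (i j k : ℕ) (s : State) :
      Runs (.add i j k) s (s.setReg i (s.reg j + s.reg k))
        (1 + (s.reg j).size + (s.reg k).size)
  | sub (i j k : ℕ) (s : State) :
      Runs (.sub i j k) s (s.setReg i (s.reg j - s.reg k))
        (1 + (s.reg j).size + (s.reg k).size)
  | load (i j : ℕ) (s : State) :
      Runs (.load i j) s (s.setReg i (s.mem (s.reg j)))
        (1 + (s.reg j).size + (s.mem (s.reg j)).size)
  | store (i j : ℕ) (s : State) :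
      Runs (.store i j) s (s.setMem (s.reg i) (s.reg j))
        (1 + (s.reg i).size + (s.reg j).size)
  | seq {p q : Program} {s s' s'' : State} {t t' : ℕ} :
      Runs p s s' t → Runs q s' s'' t' → Runs (.seq p q) s s'' (t + t')
  | cond_true {i : ℕ} {p q : Program} {s s' : State} {t : ℕ} :
      s.reg i ≠ 0 → Runs p s s' t → Runs (.cond i p q) s s' (1 + (s.reg i).size + t)
  | cond_false {i : ℕ} {p q : Program} {s s' : State} {t : ℕ} :
      s.reg i = 0 → Runs q s s' t → Runs (.cond i p q) s s' (1 + (s.reg i).size + t)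
  | loop_done {i : ℕ} {p : Program} {s : State} :
      s.reg i = 0 → Runs (.loop i p) s s (1 + (s.reg i).size)
  | loop_step {i : ℕ} {p : Program} {s s' s'' : State} {t t' : ℕ} :
      s.reg i ≠ 0 → Runs p s s' t → Runs (.loop i p) s' s'' t' →
      Runs (.loop i p) s s'' (1 + (s.reg i).size + t + t')

/-- The machine is deterministic: final state and cost are functions of program and start state. -/
theorem Runs.deterministic {p : Program} {s s₁ s₂ : State} {t₁ t₂ : ℕ}
    (h₁ : Runs p s s₁ t₁) (h₂ : Runs p s s₂ t₂) : s₁ = s₂ ∧ t₁ = t₂ := by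
  induction h₁ generalizing s₂ t₂ with
  | skip | const | add | sub | load | store => cases h₂; exact ⟨rfl, rfl⟩
  | seq _ _ ih ih' =>
    cases h₂ with
    | seq a b =>
      obtain ⟨rfl, rfl⟩ := ih a
      obtain ⟨rfl, rfl⟩ := ih' b
      exact ⟨rfl, rfl⟩
  | cond_true h _ ih =>
    cases h₂ with
    | cond_true _ a => obtain ⟨rfl, rfl⟩ := ih a; exact ⟨rfl, rfl⟩
    | cond_false h' _ => exact absurd h' h
  | cond_false h _ ih =>
    cases h₂ with
    | cond_true h' _ => exact absurd h h'
    | cond_false _ a => obtain ⟨rfl, rfl⟩ := ih a; exact ⟨rfl, rfl⟩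
  | loop_done h =>
    cases h₂ with
    | loop_done _ => exact ⟨rfl, rfl⟩
    | loop_step h' _ _ => exact absurd h h'
  | loop_step h _ _ ih ih' =>
    cases h₂ with
    | loop_done h' => exact absurd h' h
    | loop_step _ a b =>
      obtain ⟨rfl, rfl⟩ := ih a
      obtain ⟨rfl, rfl⟩ := ih' b
      exact ⟨rfl, rfl⟩

end RAM

/-! ### Counting orthogonal vectors -/

namespace OrthogonalVectors

/-- The number of pairs `(i, j)` with `⟨uᵢ, vⱼ⟩ = 0`, the inner product being taken over `ℤ`. -/
def count {n d : ℕ} (u v : Fin n → Fin d → Bool) : ℕ :=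
  (Finset.univ.filter fun p : Fin n × Fin n =>
    ∑ l : Fin d, ((u p.1 l).toNat : ℤ) * ((v p.2 l).toNat : ℤ) = 0).card

/-- The entry in row `a / d` and column `a % d` of an `n × d` table of bits written row by row, and
`0` beyond the end of the table. -/
def entry {n d : ℕ} (u : Fin n → Fin d → Bool) (a : ℕ) : ℕ :=
  if h : a < n * d then
    (u ⟨a / d, Nat.div_lt_of_lt_mul (by rwa [Nat.mul_comm] at h)⟩
      ⟨a % d, Nat.mod_lt a (Nat.pos_of_ne_zero (by rintro rfl; simp at h))⟩).toNat
  else 0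

/-- The start state on input `u₁, …, uₙ, v₁, …, vₙ ∈ {0,1}ᵈ`: register `0` holds `n`, register `1`
holds `d`, the memory cells `0, …, nd - 1` hold the bits of `u₁, …, uₙ`, the cells
`nd, …, 2nd - 1` those of `v₁, …, vₙ`, one bit per cell; all other registers and cells are `0`. -/
def input {n d : ℕ} (u v : Fin n → Fin d → Bool) : RAM.State where
  reg i := if i = 0 then n else if i = 1 then d else 0
  mem a := if a < n * d then entry u a else entry v (a - n * d)

end OrthogonalVectors

namespace OrthogonalVectors

/-! ### Choosing how to enumerate -/

/-! The idea is a sparse signed factorization of the disjointness matrix. On a block of `b`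
coordinates with sets `X` and `Y`, disjointness can be tested in three ways: the left side lists all
subsets of the complement of `X` and the right side presents `Y`; the same with the sides exchanged;
or both sides list all their subsets, and the common ones, counted with sign `(-1) ^ |S|`, cancel
unless `X ∩ Y` is empty (`sum_setSign`). For weights `a` and `c` the base-2 logarithms of the list
lengths are `(b - a, 0)`, `(0, b - c)` and `(a, c)`. Their average is `(b / 3, b / 3)` whatever `a`
and `c` are.

Hence, over many blocks, modes can be chosen such that both totals exceed a third of the length only
by a lower order term; a quadratic potential replaces a random choice (`exists_mode_step`,
`exists_modes`). The choice depends on the block weights of both vectors. Each side knows only its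
own, so it lists keys for every guess of the other's, and equality of keys enforces the right guess.
For suitable constants the list length on `κ` bits is at most `1.26 ^ κ`, because `2 < 1.26 ^ 3`
(`exists_block_sizes`, `exists_factorization`).

Cutting vectors of any length into blocks of the constant length `κ` and concatenating keys as
digits in base `K` gives a Kronecker power of this factorization (`Factorization.pairing_leaves`).
The count is the sum of the pairings of all rows. Exchanging sums, it is enough to tabulate how
often each left key occurs and to add up the table entries at the right keys with their signs
(`posTotal_sub_negTotal`), which takes time linear in `n`. Keys serve directly as memory addresses:
there are exponentially many, but an address costs only its bit length, and untouched cells are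
zero. The factorization for `κ` bits is written into the program text, so a single program serves
all inputs (`exec_countProgram_input`, `cost_bound`). -/

/-- The three ways to treat a block of coordinates: the left vector, the right vector, or both
enumerate subsets. -/
inductive Mode where
  | left | right | both

/-- The binary logarithm of the number of keys of a left block of length `b` and weight `a`. -/
def leftCost (b : ℕ) (o : Mode) (a : ℕ) : ℕ :=
  match o with
  | .left => b - a
  | .right => 0
  | .both => a

/-- The binary logarithm of the number of keys of a right block of length `b` and weight `a`. -/
def rightCost (b : ℕ) (o : Mode) (a : ℕ) : ℕ :=
  match o with
  | .left => 0
  | .right => b - a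
  | .both => a

/-- The squared positive part has derivative `2 * max P 0`, and its slope grows at rate at most 2,
so its second order expansion is an upper bound. -/
theorem sq_max_add_le (P x : ℤ) : (max (P + x) 0) ^ 2 ≤ (max P 0) ^ 2 + 2 * max P 0 * x + x ^ 2 := by
  rcases le_total P 0 with h | h <;> rcases le_total (P + x) 0 with h' | h' <;>
    simp only [max_eq_left, max_eq_right, h, h'] <;> nlinarith

theorem exists_mode_step (b a c : ℕ) (ha : a ≤ b) (hc : c ≤ b) (P Q : ℤ) :
    ∃ o : Mode, (max (P + (3 * leftCost b o a - b)) 0) ^ 2 +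
      (max (Q + (3 * rightCost b o c - b)) 0) ^ 2 ≤
        (max P 0) ^ 2 + (max Q 0) ^ 2 + 8 * (b : ℤ) ^ 2 := by
  -- Both linear coefficients sum to zero over the three modes, so the three expressions cannot all
  -- be positive.
  have key : ∃ o : Mode, max P 0 * (3 * (leftCost b o a : ℤ) - b) +
      max Q 0 * (3 * (rightCost b o c : ℤ) - b) ≤ 0 := by
    by_contra! h
    have h1 := h .left
    have h2 := h .right
    have h3 := h .both
    simp only [leftCost, rightCost, Nat.cast_sub ha, Nat.cast_sub hc, Nat.cast_zero] at h1 h2 h3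
    nlinarith
  obtain ⟨o, ho⟩ := key
  refine ⟨o, ?_⟩
  -- The deviation lies between `-b` and `2 * b`.
  have hx : (3 * (leftCost b o a : ℤ) - b) ^ 2 ≤ 4 * (b : ℤ) ^ 2 := by
    have h : leftCost b o a ≤ b := by cases o <;> simp [leftCost, ha]
    have : (leftCost b o a : ℤ) ≤ b := by exact_mod_cast h
    nlinarith [(Nat.cast_nonneg (leftCost b o a) : (0 : ℤ) ≤ _)]
  have hy : (3 * (rightCost b o c : ℤ) - b) ^ 2 ≤ 4 * (b : ℤ) ^ 2 := by
    have h : rightCost b o c ≤ b := by cases o <;> simp [rightCost, hc]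
    have : (rightCost b o c : ℤ) ≤ b := by exact_mod_cast h
    nlinarith [(Nat.cast_nonneg (rightCost b o c) : (0 : ℤ) ≤ _)]
  have h1 := sq_max_add_le P (3 * leftCost b o a - b)
  have h2 := sq_max_add_le Q (3 * rightCost b o c - b)
  linarith

theorem exists_modes_potential (b m : ℕ) (a c : Fin m → ℕ) (ha : ∀ j, a j ≤ b)
    (hc : ∀ j, c j ≤ b) :
    ∃ o : Fin m → Mode,
      (max (3 * (∑ j, leftCost b (o j) (a j) : ℕ) - m * b : ℤ) 0) ^ 2 +
        (max (3 * (∑ j, rightCost b (o j) (c j) : ℕ) - m * b : ℤ) 0) ^ 2 ≤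
          8 * m * (b : ℤ) ^ 2 := by
  induction m with
  | zero => exact ⟨fun j => j.elim0, by simp⟩
  | succ m ih =>
    obtain ⟨o, ho⟩ := ih (a ∘ Fin.castSucc) (c ∘ Fin.castSucc) (fun j => ha _) (fun j => hc _)
    obtain ⟨e, he⟩ := exists_mode_step b (a (Fin.last m)) (c (Fin.last m)) (ha _) (hc _)
      (3 * (∑ j, leftCost b (o j) ((a ∘ Fin.castSucc) j) : ℕ) - m * b)
      (3 * (∑ j, rightCost b (o j) ((c ∘ Fin.castSucc) j) : ℕ) - m * b)
    refine ⟨Fin.snoc o e, ?_⟩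
    simp only [Fin.sum_univ_castSucc, Fin.snoc_castSucc, Fin.snoc_last]
    simp only [Function.comp_apply] at ho he
    push_cast at ho he ⊢
    calc _ = _ := by congr 3 <;> ring
      _ ≤ _ := he
      _ ≤ _ := by linarith

/-- With `m = 8 * s ^ 2` blocks the potential bound `8 * m * b ^ 2` is the perfect square `(8 * s *
b) ^ 2`. The excess `8 * s * b` is then a fraction `1 / s` of the main term `m * b`. -/
theorem exists_modes (b s : ℕ) (a c : Fin (8 * s ^ 2) → ℕ) (ha : ∀ j, a j ≤ b)
    (hc : ∀ j, c j ≤ b) :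
    ∃ o : Fin (8 * s ^ 2) → Mode,
      3 * ∑ j, leftCost b (o j) (a j) ≤ 8 * s ^ 2 * b + 8 * s * b ∧
        3 * ∑ j, rightCost b (o j) (c j) ≤ 8 * s ^ 2 * b + 8 * s * b := by
  obtain ⟨o, ho⟩ := exists_modes_potential b _ a c ha hc
  have aux : ∀ x y : ℤ, (max x 0) ^ 2 + (max y 0) ^ 2 ≤ (8 * s * b) ^ 2 → x ≤ 8 * s * b := by
    intro x y h
    refine (le_max_left x 0).trans (abs_le_of_sq_le_sq' ?_ (by positivity)).2
    nlinarith [sq_nonneg (max y 0)]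
  have e : (8 * (8 * s ^ 2 : ℕ) * (b : ℤ) ^ 2) = (8 * s * b : ℤ) ^ 2 := by push_cast; ring
  rw [e] at ho
  have h1 := aux _ _ ho
  have h2 := aux _ _ (by rw [add_comm]; exact ho)
  refine ⟨o, ?_, ?_⟩ <;> zify <;> push_cast at h1 h2 ⊢ <;> linarith

/-! ### A sparse factorization of the disjointness matrix -/

/-- The subsets enumerated for a left block `X`. -/
def leftSets {b : ℕ} (o : Mode) (X : Finset (Fin b)) : Finset (Finset (Fin b)) :=
  match o with
  | .left => Xᶜ.powerset
  | .right => {X}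
  | .both => X.powerset

/-- The subsets enumerated for a right block `Y`. -/
def rightSets {b : ℕ} (o : Mode) (Y : Finset (Fin b)) : Finset (Finset (Fin b)) :=
  match o with
  | .left => {Y}
  | .right => Yᶜ.powerset
  | .both => Y.powerset

/-- The sign with which a subset counts. -/
def setSign {b : ℕ} (o : Mode) (S : Finset (Fin b)) : ℤ :=
  match o with
  | .left => 1
  | .right => 1
  | .both => (-1) ^ S.card

theorem card_leftSets {b : ℕ} (o : Mode) (X : Finset (Fin b)) :
    (leftSets o X).card = 2 ^ leftCost b o X.card := by
  cases o <;> simp [leftSets, leftCost, Finset.card_powerset, Finset.card_compl]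

theorem card_rightSets {b : ℕ} (o : Mode) (Y : Finset (Fin b)) :
    (rightSets o Y).card = 2 ^ rightCost b o Y.card := by
  cases o <;> simp [rightSets, rightCost, Finset.card_powerset, Finset.card_compl]

/-- In the two one-sided modes the only candidate for a common set is the full set of the other
side, present exactly when it avoids the first set. In the two-sided mode the sum is the alternating
sum over all subsets of `X ∩ Y`. -/
theorem sum_setSign {b : ℕ} (o : Mode) (X Y : Finset (Fin b)) :
    ∑ S ∈ leftSets o X ∩ rightSets o Y, setSign o S = if Disjoint X Y then 1 else 0 := by
  cases o with
  | left =>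
    simp only [leftSets, rightSets, setSign, Finset.sum_const, nsmul_eq_mul, mul_one]
    by_cases h : Disjoint X Y
    · rw [Finset.inter_singleton_of_mem (by
        simpa [Finset.subset_compl_iff_disjoint_left] using h)]
      simp [h]
    · rw [Finset.inter_singleton_of_notMem (by
        simpa [Finset.subset_compl_iff_disjoint_left] using h)]
      simp [h]
  | right =>
    simp only [leftSets, rightSets, setSign, Finset.sum_const, nsmul_eq_mul, mul_one]
    by_cases h : Disjoint X Y
    · rw [Finset.singleton_inter_of_mem (by
        simpa [Finset.subset_compl_iff_disjoint_right] using h)]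
      simp [h]
    · rw [Finset.singleton_inter_of_notMem (by
        simpa [Finset.subset_compl_iff_disjoint_right] using h)]
      simp [h]
  | both =>
    have e : leftSets .both X ∩ rightSets .both Y = (X ∩ Y).powerset := by
      ext S
      simp only [leftSets, rightSets, Finset.mem_inter, Finset.mem_powerset, Finset.subset_inter_iff]
    simp only [e, setSign, Finset.sum_powerset_neg_one_pow_card, Finset.disjoint_iff_inter_eq_empty]

/-- The block weights of a vector that is cut into `m` blocks of length `b`. -/
def blockWeights {m b : ℕ} (X : Fin m → Finset (Fin b)) (j : Fin m) : Fin (b + 1) :=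
  ⟨(X j).card, Nat.lt_succ_of_le (by simpa using Finset.card_le_univ (X j))⟩

/-- Keys: the block weights of both vectors and a set in each block. -/
abbrev Key (m b : ℕ) : Type :=
  ((Fin m → Fin (b + 1)) × (Fin m → Fin (b + 1))) × (Fin m → Finset (Fin b))

/-- A rule that selects the modes from the block weights. -/
abbrev Rule (m b : ℕ) : Type :=
  (Fin m → Fin (b + 1)) × (Fin m → Fin (b + 1)) → Fin m → Mode

/-- The keys of a left vector. -/
def leftKeys {m b : ℕ} (f : Rule m b) (X : Fin m → Finset (Fin b)) : Finset (Key m b) :=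
  Finset.univ.filter fun k => k.1.1 = blockWeights X ∧ ∀ j, k.2 j ∈ leftSets (f k.1 j) (X j)

/-- The keys of a right vector. -/
def rightKeys {m b : ℕ} (f : Rule m b) (Y : Fin m → Finset (Fin b)) : Finset (Key m b) :=
  Finset.univ.filter fun k => k.1.2 = blockWeights Y ∧ ∀ j, k.2 j ∈ rightSets (f k.1 j) (Y j)

/-- The sign of a key. -/
def keySign {m b : ℕ} (f : Rule m b) (k : Key m b) : ℤ := ∏ j, setSign (f k.1 j) (k.2 j)

/-- A common key must carry the true block weights of both vectors, so the modes are determined. The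
sum over the sets then factors into a product over the blocks. -/
theorem sum_keySign {m b : ℕ} (f : Rule m b) (X Y : Fin m → Finset (Fin b)) :
    ∑ k ∈ leftKeys f X ∩ rightKeys f Y, keySign f k =
      if ∀ j, Disjoint (X j) (Y j) then 1 else 0 := by
  have e : leftKeys f X ∩ rightKeys f Y =
      (Fintype.piFinset fun j => leftSets (f (blockWeights X, blockWeights Y) j) (X j) ∩
        rightSets (f (blockWeights X, blockWeights Y) j) (Y j)).image
          fun S => (((blockWeights X, blockWeights Y), S) : Key m b) := by
    ext ⟨⟨t, t'⟩, S⟩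
    simp only [leftKeys, rightKeys, Finset.mem_inter, Finset.mem_filter, Finset.mem_univ, true_and,
      Finset.mem_image, Fintype.mem_piFinset, Prod.mk.injEq]
    constructor
    · rintro ⟨⟨rfl, h⟩, rfl, h'⟩
      exact ⟨S, fun j => ⟨h j, h' j⟩, ⟨rfl, rfl⟩, rfl⟩
    · rintro ⟨S', h, ⟨rfl, rfl⟩, rfl⟩
      exact ⟨⟨rfl, fun j => (h j).1⟩, rfl, fun j => (h j).2⟩
  rw [e, Finset.sum_image (fun S _ T _ h => (Prod.mk.inj h).2)]
  simp only [keySign]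
  rw [← Finset.prod_univ_sum]
  simp only [sum_setSign]
  by_cases h : ∀ j, Disjoint (X j) (Y j)
  · simp [h]
  · rw [if_neg h]
    push Not at h
    obtain ⟨j, hj⟩ := h
    exact Finset.prod_eq_zero (Finset.mem_univ j) (if_neg hj)

/-- The factor `(b + 1) ^ m` counts the guesses for the block weights of the unknown right vector;
for each guess the number of sets is a product of powers of two. -/
theorem card_leftKeys_le {m b N : ℕ} (f : Rule m b) (X : Fin m → Finset (Fin b))
    (h : ∀ t, ∑ j, leftCost b (f (blockWeights X, t) j) (X j).card ≤ N) :
    (leftKeys f X).card ≤ (b + 1) ^ m * 2 ^ N := by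
  have hsub : leftKeys f X ⊆ Finset.univ.biUnion fun t : Fin m → Fin (b + 1) =>
      (Fintype.piFinset fun j => leftSets (f (blockWeights X, t) j) (X j)).image
        fun S => (((blockWeights X, t), S) : Key m b) := by
    rintro ⟨⟨t, t'⟩, S⟩ hk
    simp only [leftKeys, Finset.mem_filter, Finset.mem_univ, true_and] at hk
    obtain ⟨rfl, hS⟩ := hk
    simp only [Finset.mem_biUnion, Finset.mem_univ, true_and, Finset.mem_image,
      Fintype.mem_piFinset]
    exact ⟨t', S, hS, rfl⟩
  refine (Finset.card_le_card hsub).trans ((Finset.card_biUnion_le_card_mul _ _ (2 ^ N) ?_).trans ?_)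
  · intro t _
    refine Finset.card_image_le.trans ?_
    simp only [Fintype.card_piFinset, card_leftSets, Finset.prod_pow_eq_pow_sum]
    exact Nat.pow_le_pow_right (by norm_num) (h t)
  · simp

theorem card_rightKeys_le {m b N : ℕ} (f : Rule m b) (Y : Fin m → Finset (Fin b))
    (h : ∀ t, ∑ j, rightCost b (f (t, blockWeights Y) j) (Y j).card ≤ N) :
    (rightKeys f Y).card ≤ (b + 1) ^ m * 2 ^ N := by
  have hsub : rightKeys f Y ⊆ Finset.univ.biUnion fun t : Fin m → Fin (b + 1) =>
      (Fintype.piFinset fun j => rightSets (f (t, blockWeights Y) j) (Y j)).image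
        fun S => (((t, blockWeights Y), S) : Key m b) := by
    rintro ⟨⟨t, t'⟩, S⟩ hk
    simp only [rightKeys, Finset.mem_filter, Finset.mem_univ, true_and] at hk
    obtain ⟨rfl, hS⟩ := hk
    simp only [Finset.mem_biUnion, Finset.mem_univ, true_and, Finset.mem_image,
      Fintype.mem_piFinset]
    exact ⟨t, S, hS, rfl⟩
  refine (Finset.card_le_card hsub).trans ((Finset.card_biUnion_le_card_mul _ _ (2 ^ N) ?_).trans ?_)
  · intro t _
    refine Finset.card_image_le.trans ?_
    simp only [Fintype.card_piFinset, card_rightSets, Finset.prod_pow_eq_pow_sum]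
    exact Nat.pow_le_pow_right (by norm_num) (h t)
  · simp

theorem exists_rule (b s : ℕ) : ∃ (f : Rule (8 * s ^ 2) b) (N : ℕ),
    3 * N ≤ 8 * s ^ 2 * b + 8 * s * b ∧
      (∀ X, (leftKeys f X).card ≤ (b + 1) ^ (8 * s ^ 2) * 2 ^ N) ∧
        ∀ Y, (rightKeys f Y).card ≤ (b + 1) ^ (8 * s ^ 2) * 2 ^ N := by
  have h : ∀ τ : (Fin (8 * s ^ 2) → Fin (b + 1)) × (Fin (8 * s ^ 2) → Fin (b + 1)), _ :=
    fun τ => exists_modes b s (fun j => τ.1 j) (fun j => τ.2 j)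
      (fun j => Nat.le_of_lt_succ (τ.1 j).2) (fun j => Nat.le_of_lt_succ (τ.2 j).2)
  choose f hf using h
  refine ⟨f, (8 * s ^ 2 * b + 8 * s * b) / 3, Nat.mul_div_le _ _, fun X => ?_, fun Y => ?_⟩
  · refine card_leftKeys_le f X fun t => ?_
    have := (hf (blockWeights X, t)).1
    simp only [blockWeights] at this ⊢
    omega
  · refine card_rightKeys_le f Y fun t => ?_
    have := (hf (t, blockWeights Y)).2
    simp only [blockWeights] at this ⊢
    omega

/-- After cubing, two factors of size `2 ^ (8 * s * b)` have to be absorbed: one from the excess in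
`exists_modes`, one from the guessed weights. Their product is `4 ^ (8 * s * b)`, and the gain
`(1.26 ^ 3 / 2) ^ (8 * s ^ 2 * b)` exceeds it once `s` is large. -/
theorem exists_block_sizes : ∃ b s : ℕ, 1 ≤ b ∧ 1 ≤ s ∧ ∀ N : ℕ,
    3 * N ≤ 8 * s ^ 2 * b + 8 * s * b →
      (((b + 1) ^ (8 * s ^ 2) * 2 ^ N : ℕ) : ℝ) ≤ (1.26 : ℝ) ^ (8 * s ^ 2 * b) := by
  -- Since `1.26 ^ 3 = 2.000376`, the base exceeds 1 by very little; this is where 1.26 being larger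
  -- than the cube root of 2 enters.
  obtain ⟨s, hs⟩ := pow_unbounded_of_one_lt (4 : ℝ) (show (1 : ℝ) < 1.26 ^ 3 / 2 by norm_num)
  have hs1 : 1 ≤ s := by
    rcases Nat.eq_zero_or_pos s with rfl | h
    · norm_num at hs
    · exact h
  have hb : ∃ b : ℕ, 1 ≤ b ∧ ((b : ℝ) + 1) ^ (3 * s) ≤ 2 ^ b := by
    have h1 := (tendsto_pow_const_div_const_pow_of_one_lt (3 * s) (show (1 : ℝ) < 2 by norm_num))
    -- The limit is applied at `c = b + 1`; the threshold `1 / 2` turns `2 ^ (b + 1)` into `2 ^ b`.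
    have h2 := (h1.eventually (gt_mem_nhds (show (0 : ℝ) < 1 / 2 by norm_num)))
    obtain ⟨c, hc, hc2⟩ := (h2.and (Filter.eventually_ge_atTop 2)).exists
    refine ⟨c - 1, by omega, ?_⟩
    obtain ⟨e, rfl⟩ : ∃ e, c = e + 1 := ⟨c - 1, by omega⟩
    rw [div_lt_iff₀ (by positivity)] at hc
    rw [Nat.add_sub_cancel]
    push_cast at hc
    refine hc.le.trans (le_of_eq ?_)
    rw [pow_succ]; ring
  obtain ⟨b, hb1, hb⟩ := hb
  refine ⟨b, s, hb1, hs1, fun N hN => ?_⟩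
  refine le_of_pow_le_pow_left₀ (n := 3) (by norm_num) (by positivity) ?_
  push_cast
  calc (((b : ℝ) + 1) ^ (8 * s ^ 2) * 2 ^ N) ^ 3
      = (((b : ℝ) + 1) ^ (3 * s)) ^ (8 * s) * 2 ^ (3 * N) := by
        rw [mul_pow, ← pow_mul, ← pow_mul, ← pow_mul, mul_comm N 3]; congr 2; ring
    _ ≤ (2 ^ b) ^ (8 * s) * 2 ^ (8 * s ^ 2 * b + 8 * s * b) := by
        gcongr
        norm_num
    _ = 4 ^ (8 * s * b) * 2 ^ (8 * s ^ 2 * b) := by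
        rw [show (4 : ℝ) = 2 ^ 2 by norm_num]
        simp only [← pow_mul, ← pow_add]; congr 1; ring
    _ ≤ ((1.26 ^ 3 / 2) ^ s) ^ (8 * s * b) * 2 ^ (8 * s ^ 2 * b) := by gcongr
    _ = (1.26 ^ (8 * s ^ 2 * b)) ^ 3 := by
        rw [← pow_mul, show s * (8 * s * b) = 8 * s ^ 2 * b by ring, ← mul_pow, ← pow_mul,
          mul_comm _ 3, pow_mul _ 3]
        congr 1; norm_num

/-! ### Signed lists of keys -/

/-- The sign that a bit stands for. -/
def bitSign (s : Bool) : ℤ := if s then -1 else 1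

theorem bitSign_xor (s t : Bool) : bitSign (s ^^ t) = bitSign s * bitSign t := by
  cases s <;> cases t <;> rfl

/-- The number of common keys of two lists, counted with the signs of the second list. -/
def pairing (A B : List (ℕ × Bool)) : ℤ :=
  (A.map fun a => (B.map fun c => if a.1 = c.1 then bitSign c.2 else 0).sum).sum

theorem pairing_nil (B : List (ℕ × Bool)) : pairing [] B = 0 := rfl

theorem pairing_cons (a : ℕ × Bool) (A B : List (ℕ × Bool)) :
    pairing (a :: A) B = (B.map fun c => if a.1 = c.1 then bitSign c.2 else 0).sum + pairing A B := by
  simp [pairing]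

theorem pairing_append (A A' B : List (ℕ × Bool)) :
    pairing (A ++ A') B = pairing A B + pairing A' B := by
  simp [pairing]

theorem pairing_nil_right (A : List (ℕ × Bool)) : pairing A [] = 0 := by
  simp [pairing]

theorem pairing_append_right (A B B' : List (ℕ × Bool)) :
    pairing A (B ++ B') = pairing A B + pairing A B' := by
  induction A with
  | nil => rfl
  | cons a A ih => simp only [pairing_cons, ih, List.map_append, List.sum_append]; ring

/-- Append every digit of a list to a number written in base `K`. -/
def appendDigits (K : ℕ) (a : ℕ × Bool) (F : List (ℕ × Bool)) : List (ℕ × Bool) :=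
  F.map fun k => (K * a.1 + k.1, a.2 ^^ k.2)

theorem mul_add_eq_mul_add_iff {K a b k l : ℕ} (hk : k < K) (hl : l < K) :
    K * a + k = K * b + l ↔ a = b ∧ k = l := by
  refine ⟨fun h => ?_, fun h => by rw [h.1, h.2]⟩
  have h1 := congrArg (· / K) h
  have h2 := congrArg (· % K) h
  have hK : 0 < K := by omega
  simp only [Nat.mul_add_div hK, Nat.div_eq_of_lt hk, Nat.div_eq_of_lt hl, Nat.mul_add_mod,
    Nat.mod_eq_of_lt hk, Nat.mod_eq_of_lt hl] at h1 h2
  exact ⟨by omega, h2⟩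

theorem pairing_appendDigits {K : ℕ} (a b : ℕ × Bool) {F G : List (ℕ × Bool)}
    (hF : ∀ k ∈ F, k.1 < K) (hG : ∀ k ∈ G, k.1 < K) :
    pairing (appendDigits K a F) (appendDigits K b G) =
      (if a.1 = b.1 then bitSign b.2 else 0) * pairing F G := by
  simp only [pairing, appendDigits, List.map_map, ← List.sum_map_mul_left]
  refine congrArg List.sum (List.map_congr_left fun k hk => ?_)
  simp only [Function.comp_apply]
  refine congrArg List.sum (List.map_congr_left fun l hl => ?_)
  simp only [Function.comp_apply, mul_add_eq_mul_add_iff (hF k hk) (hG l hl), bitSign_xor]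
  by_cases h1 : a.1 = b.1 <;> by_cases h2 : k.1 = l.1 <;> simp [h1, h2]

/-- Pairing is multiplicative under Kronecker products: digits below `K` make the concatenated key
determine both of its parts, and signs multiply. -/
theorem pairing_flatMap_appendDigits {K : ℕ} (A B : List (ℕ × Bool)) {F G : List (ℕ × Bool)}
    (hF : ∀ k ∈ F, k.1 < K) (hG : ∀ k ∈ G, k.1 < K) :
    pairing (A.flatMap fun a => appendDigits K a F) (B.flatMap fun b => appendDigits K b G) =
      pairing A B * pairing F G := by
  induction A with
  | nil => simp [pairing_nil]
  | cons a A ih =>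
    rw [List.flatMap_cons, pairing_append, ih, pairing_cons, add_mul]
    congr 1
    clear ih
    induction B with
    | nil => simp [pairing_nil_right]
    | cons b B ihB =>
      rw [List.flatMap_cons, pairing_append_right, pairing_appendDigits a b hF hG, ihB, List.map_cons,
        List.sum_cons, add_mul]

/-- The bits `f (k - 1), …, f 0`. -/
def revBits (f : ℕ → Bool) : ℕ → List Bool
  | 0 => []
  | k + 1 => f k :: revBits f k

theorem length_revBits (f : ℕ → Bool) (k : ℕ) : (revBits f k).length = k := by
  induction k with
  | zero => rfl
  | succ k ih => simp [revBits, ih]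

theorem getD_revBits (f : ℕ → Bool) (k i : ℕ) (h : i < k) :
    (revBits f k).getD i false = f (k - 1 - i) := by
  induction k generalizing i with
  | zero => omega
  | succ k ih =>
    cases i with
    | zero => simp [revBits]
    | succ i =>
      rw [revBits, List.getD_cons_succ, ih i (by omega)]
      congr 1; omega

/-- The `j`-th block of `κ` bits. -/
def chunk (κ : ℕ) (f : ℕ → Bool) (j : ℕ) : List Bool := revBits (fun i => f (j * κ + i)) κ

/-- The signed base `K` numbers whose `j`-th digit comes from the list for the `j`-th block. -/
def leaves (F : List Bool → List (ℕ × Bool)) (K κ : ℕ) (f : ℕ → Bool) : ℕ → List (ℕ × Bool)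
  | 0 => [(0, false)]
  | j + 1 => (leaves F K κ f j).flatMap fun a => appendDigits K a (F (chunk κ f j))

theorem length_leaves_le {F : List Bool → List (ℕ × Bool)} {K κ L : ℕ}
    (hF : ∀ x, x.length = κ → (F x).length ≤ L) (f : ℕ → Bool) (j : ℕ) :
    (leaves F K κ f j).length ≤ L ^ j := by
  induction j with
  | zero => simp [leaves]
  | succ j ih =>
    simp only [leaves, List.length_flatMap, appendDigits, List.length_map, List.map_const',
      List.sum_replicate, smul_eq_mul, pow_succ]
    exact Nat.mul_le_mul ih (hF _ (length_revBits _ _))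

theorem leaves_lt {F : List Bool → List (ℕ × Bool)} {K κ : ℕ}
    (hF : ∀ x, ∀ k ∈ F x, k.1 < K) (f : ℕ → Bool) (j : ℕ) :
    ∀ a ∈ leaves F K κ f j, a.1 < K ^ j := by
  induction j with
  | zero => simp [leaves]
  | succ j ih =>
    simp only [leaves, List.mem_flatMap, appendDigits, List.mem_map]
    rintro _ ⟨a, ha, k, hk, rfl⟩
    have h1 := ih a ha
    have h2 := hF _ k hk
    calc K * a.1 + k.1 < K * a.1 + K := by simpa using h2
      _ = K * (a.1 + 1) := by ring
      _ ≤ K * K ^ j := Nat.mul_le_mul_left _ h1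
      _ = K ^ (j + 1) := by ring

/-- A factorization of the disjointness matrix of `κ` bits, with inner dimension `K`, whose left
factor has rows and whose right factor has columns with at most `L` nonzero entries. The rows and
columns are given as lists of keys, and the entries of the right factor have signs. -/
structure Factorization (κ K L : ℕ) where
  left : List Bool → List (ℕ × Bool)
  right : List Bool → List (ℕ × Bool)
  length_left : ∀ x, x.length = κ → (left x).length ≤ L
  length_right : ∀ x, x.length = κ → (right x).length ≤ L
  left_lt : ∀ x, ∀ k ∈ left x, k.1 < K
  right_lt : ∀ x, ∀ k ∈ right x, k.1 < K
  pairing_eq : ∀ f g : ℕ → Bool, pairing (left (revBits f κ)) (right (revBits g κ)) =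
    if ∀ i < κ, ¬ (f i = true ∧ g i = true) then 1 else 0

theorem Factorization.pairing_leaves {κ K L : ℕ} (Φ : Factorization κ K L) (f g : ℕ → Bool)
    (D : ℕ) :
    pairing (leaves Φ.left K κ f D) (leaves Φ.right K κ g D) =
      if ∀ i < D * κ, ¬ (f i = true ∧ g i = true) then 1 else 0 := by
  induction D with
  | zero => simp [leaves, pairing, bitSign]
  | succ D ih =>
    rw [leaves, leaves, pairing_flatMap_appendDigits _ _ (Φ.left_lt _) (Φ.right_lt _), ih, chunk,
      chunk, Φ.pairing_eq]
    have e : (∀ i < (D + 1) * κ, ¬ (f i = true ∧ g i = true)) ↔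
        (∀ i < D * κ, ¬ (f i = true ∧ g i = true)) ∧
          ∀ i < κ, ¬ (f (D * κ + i) = true ∧ g (D * κ + i) = true) := by
      rw [Nat.succ_mul]
      refine ⟨fun h => ⟨fun i hi => h i (by omega), fun i hi => h _ (by omega)⟩, fun h i hi => ?_⟩
      rcases lt_or_ge i (D * κ) with h' | h'
      · exact h.1 i h'
      · have := h.2 (i - D * κ) (by omega)
        rwa [Nat.add_sub_cancel' h'] at this
    simp only [e]
    split_ifs <;> simp_all

/-! ### A factorization of the disjointness matrix within the budget `1.26 ^ κ` -/

theorem setSign_sq {b : ℕ} (o : Mode) (S : Finset (Fin b)) : setSign o S ^ 2 = 1 := by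
  cases o
  · rfl
  · rfl
  · rw [setSign, ← pow_mul, mul_comm, pow_mul]; simp

theorem bitSign_decide_keySign {m b : ℕ} (f : Rule m b) (k : Key m b) :
    bitSign (decide (keySign f k = -1)) = keySign f k := by
  have h : keySign f k ^ 2 = 1 := by simp [keySign, ← Finset.prod_pow, setSign_sq]
  rcases Int.isUnit_iff.mp (IsUnit.of_mul_eq_one _ (by rw [← sq]; exact h)) with h | h <;> simp [h, bitSign]

/-- The sets of positions of the ones in the blocks of a vector. -/
def blocksOf (m b : ℕ) (x : List Bool) (j : Fin m) : Finset (Fin b) :=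
  Finset.univ.filter fun i => x.getD (finProdFinEquiv (j, i)) false = true

theorem disjoint_blocksOf_iff (m b : ℕ) (x y : List Bool) :
    (∀ j, Disjoint (blocksOf m b x j) (blocksOf m b y j)) ↔
      ∀ i < m * b, ¬ (x.getD i false = true ∧ y.getD i false = true) := by
  simp only [blocksOf, Finset.disjoint_filter, Finset.mem_univ, true_imp_iff, not_and]
  constructor
  · intro h i hi
    simpa only [Prod.mk.eta, Equiv.apply_symm_apply] using
      h (finProdFinEquiv.symm ⟨i, hi⟩).1 (finProdFinEquiv.symm ⟨i, hi⟩).2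
  · intro h j i
    exact h _ (finProdFinEquiv (j, i)).2

theorem pairing_map_toList {α : Type*} [DecidableEq α] (A B : Finset α) (e : α → ℕ)
    (he : Function.Injective e) (σ : α → Bool) :
    pairing (A.toList.map fun k => (e k, false)) (B.toList.map fun k => (e k, σ k)) =
      ∑ k ∈ A ∩ B, bitSign (σ k) := by
  simp only [pairing, List.map_map, Function.comp_def, he.eq_iff, Finset.sum_map_toList,
    Finset.sum_ite_eq]
  rw [Finset.sum_ite_mem]

theorem exists_factorization : ∃ κ K L : ℕ, 1 ≤ κ ∧ 1 ≤ L ∧ (L : ℝ) ≤ 1.26 ^ κ ∧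
    Nonempty (Factorization κ K L) := by
  obtain ⟨b, s, hb, hs, h⟩ := exists_block_sizes
  obtain ⟨f, N, hN, hl, hr⟩ := exists_rule b s
  -- Keys are numbered from 0 below `K`, so that they can serve as digits in base `K`.
  let e : Key (8 * s ^ 2) b → ℕ := fun k => Fintype.equivFin _ k
  have he : Function.Injective e := fun k l hkl =>
    (Fintype.equivFin _).injective (Fin.ext hkl)
  refine ⟨8 * s ^ 2 * b, Fintype.card (Key (8 * s ^ 2) b), (b + 1) ^ (8 * s ^ 2) * 2 ^ N,
    ?_, ?_, h N hN, ⟨⟨fun x => (leftKeys f (blocksOf _ b x)).toList.map fun k => (e k, false),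
      fun x => (rightKeys f (blocksOf _ b x)).toList.map fun k => (e k, decide (keySign f k = -1)),
      ?_, ?_, ?_, ?_, ?_⟩⟩⟩
  · exact Nat.mul_pos (by positivity) hb
  · exact Nat.succ_le_of_lt (by positivity)
  · intro x _
    simpa using hl _
  · intro x _
    simpa using hr _
  · intro x k hk
    obtain ⟨k', -, rfl⟩ := List.mem_map.mp hk
    exact (Fintype.equivFin _ k').2
  · intro x k hk
    obtain ⟨k', -, rfl⟩ := List.mem_map.mp hk
    exact (Fintype.equivFin _ k').2
  · intro u v
    simp only [pairing_map_toList _ _ e he, bitSign_decide_keySign, sum_keySign]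
    refine if_congr ?_ rfl rfl
    rw [disjoint_blocksOf_iff]
    constructor
    · intro h i hi
      -- The bits are listed in reverse order; the reflection of positions does not affect
      -- disjointness.
      have := h (8 * s ^ 2 * b - 1 - i) (by omega)
      rwa [getD_revBits _ _ _ (by omega), getD_revBits _ _ _ (by omega),
        show 8 * s ^ 2 * b - 1 - (8 * s ^ 2 * b - 1 - i) = i by omega] at this
    · intro h i hi
      rw [getD_revBits _ _ _ hi, getD_revBits _ _ _ hi]
      exact h _ (by omega)

end OrthogonalVectors

namespace RAM

/-! ### Executions with a bound on the cost -/

/-- The program runs from `s` to `s'` at a cost of at most `c` times the cost of an instruction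
with operands of `B` bits. -/
def Exec (B : ℕ) (p : Program) (s s' : State) (c : ℕ) : Prop :=
  ∃ t, Runs p s s' t ∧ t ≤ c * (2 * B + 1)

/-- All registers and all cells hold numbers of at most `B` bits. -/
def Bounded (B : ℕ) (s : State) : Prop := (∀ i, s.reg i < 2 ^ B) ∧ ∀ a, s.mem a < 2 ^ B

theorem Bounded.mono {B B' : ℕ} {s : State} (h : Bounded B s) (hB : B ≤ B') : Bounded B' s :=
  have e : 2 ^ B ≤ 2 ^ B' := Nat.pow_le_pow_right (by norm_num) hB
  ⟨fun i => (h.1 i).trans_le e, fun a => (h.2 a).trans_le e⟩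

theorem Bounded.setReg {B : ℕ} {s : State} (h : Bounded B s) (i : ℕ) {x : ℕ} (hx : x < 2 ^ B) :
    Bounded B (s.setReg i x) := by
  refine ⟨fun j => ?_, h.2⟩
  simp only [State.setReg, Function.update_apply]
  split_ifs
  exacts [hx, h.1 j]

theorem Bounded.setMem {B : ℕ} {s : State} (h : Bounded B s) (i : ℕ) {x : ℕ} (hx : x < 2 ^ B) :
    Bounded B (s.setMem i x) := by
  refine ⟨h.1, fun j => ?_⟩
  simp only [State.setMem, Function.update_apply]
  split_ifs
  exacts [hx, h.2 j]

theorem Exec.mono {B c c' : ℕ} {p : Program} {s s' : State} (h : Exec B p s s' c) (hc : c ≤ c') :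
    Exec B p s s' c' :=
  let ⟨t, h, ht⟩ := h
  ⟨t, h, ht.trans (Nat.mul_le_mul_right _ hc)⟩

theorem Exec.seq {B c c' : ℕ} {p q : Program} {s s' s'' : State} (h : Exec B p s s' c)
    (h' : Exec B q s' s'' c') : Exec B (.seq p q) s s'' (c + c') := by
  obtain ⟨t, h, ht⟩ := h
  obtain ⟨t', h', ht'⟩ := h'
  exact ⟨_, h.seq h', by rw [add_mul]; omega⟩

theorem Exec.cond_true {B c i : ℕ} {p q : Program} {s s' : State} (hi : s.reg i ≠ 0)
    (hB : s.reg i < 2 ^ B) (h : Exec B p s s' c) : Exec B (.cond i p q) s s' (c + 1) := by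
  obtain ⟨t, h, ht⟩ := h
  have := Nat.size_le.2 hB
  exact ⟨_, .cond_true hi h, by rw [add_mul]; omega⟩

theorem Exec.cond_false {B c i : ℕ} {p q : Program} {s s' : State} (hi : s.reg i = 0)
    (h : Exec B q s s' c) : Exec B (.cond i p q) s s' (c + 1) := by
  obtain ⟨t, h, ht⟩ := h
  exact ⟨_, .cond_false hi h, by rw [add_mul, hi, Nat.size_zero]; omega⟩

theorem Exec.loop_done {B i : ℕ} {p : Program} {s : State} (hi : s.reg i = 0) :
    Exec B (.loop i p) s s 1 :=
  ⟨_, .loop_done hi, by rw [hi, Nat.size_zero]; omega⟩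

theorem Exec.loop_step {B c c' i : ℕ} {p : Program} {s s' s'' : State} (hi : s.reg i ≠ 0)
    (hB : s.reg i < 2 ^ B) (h : Exec B p s s' c) (h' : Exec B (.loop i p) s' s'' c') :
    Exec B (.loop i p) s s'' (c + 1 + c') := by
  obtain ⟨t, h, ht⟩ := h
  obtain ⟨t', h', ht'⟩ := h'
  have := Nat.size_le.2 hB
  exact ⟨_, .loop_step hi h h', by simp only [add_mul]; omega⟩

theorem Exec.loop_invariant {B c i N : ℕ} {p : Program} (Inv : ℕ → State → Prop)
    (hend : ∀ s, Inv N s → s.reg i = 0)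
    (hstep : ∀ k < N, ∀ s, Inv k s →
      s.reg i ≠ 0 ∧ s.reg i < 2 ^ B ∧ ∃ s', Exec B p s s' c ∧ Inv (k + 1) s')
    {s : State} (h0 : Inv 0 s) : ∃ s', Exec B (.loop i p) s s' (N * (c + 1) + 1) ∧ Inv N s' := by
  suffices H : ∀ m k, k + m = N → ∀ s, Inv k s →
      ∃ s', Exec B (.loop i p) s s' (m * (c + 1) + 1) ∧ Inv N s' from
    H N 0 (by omega) s h0
  intro m
  induction m with
  | zero =>
    rintro k rfl s h
    exact ⟨s, (Exec.loop_done (hend s h)).mono (by omega), h⟩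
  | succ m ih =>
    intro k hk s h
    obtain ⟨h1, h2, s', h3, h4⟩ := hstep k (by omega) s h
    obtain ⟨s'', h5, h6⟩ := ih (k + 1) (by omega) s' h4
    exact ⟨s'', (h3.loop_step h1 h2 h5).mono (by rw [Nat.succ_mul]; omega), h6⟩

/-! ### Programs without loops -/

/-- The program has no loop. -/
def Program.Straight : Program → Prop
  | .seq p q => p.Straight ∧ q.Straight
  | .cond _ p q => p.Straight ∧ q.Straight
  | .loop _ _ => False
  | _ => True

/-- The final state of a program without loops. -/
def Program.eval : Program → State → State
  | .skip, s => s
  | .const i c, s => s.setReg i c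
  | .add i j k, s => s.setReg i (s.reg j + s.reg k)
  | .sub i j k, s => s.setReg i (s.reg j - s.reg k)
  | .load i j, s => s.setReg i (s.mem (s.reg j))
  | .store i j, s => s.setMem (s.reg i) (s.reg j)
  | .seq p q, s => q.eval (p.eval s)
  | .cond i p q, s => if s.reg i = 0 then q.eval s else p.eval s
  | .loop _ _, s => s

/-- The number of instructions of a program, plus the length of the constants. -/
def Program.weight : Program → ℕ
  | .const _ c => 1 + c.size
  | .seq p q => p.weight + q.weight
  | .cond _ p q => 1 + p.weight + q.weight
  | .loop _ p => p.weight
  | _ => 1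

/-- An addition lengthens numbers by at most one bit, and a constant brings in only its own length.
So operands never exceed `B + p.weight` bits, and intermediate states need no separate bounds. -/
theorem Program.Straight.runs_eval {p : Program} (hp : p.Straight) {B : ℕ} {s : State}
    (hs : Bounded B s) : ∃ t, Runs p s (p.eval s) t ∧ t ≤ p.weight * (2 * (B + p.weight) + 1) ∧
      Bounded (B + p.weight) (p.eval s) := by
  induction p generalizing B s with
  | skip => exact ⟨1, .skip s, by simp [Program.weight], hs.mono (by omega)⟩
  | const i c =>
    refine ⟨_, .const i c s, ?_, ?_⟩
    · simp only [Program.weight]; nlinarith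
    · refine (hs.mono (by omega)).setReg i ((Nat.lt_size_self c).trans_le ?_)
      exact Nat.pow_le_pow_right (by norm_num) (by simp only [Program.weight]; omega)
  | add i j k =>
    refine ⟨_, .add i j k s, ?_, (hs.mono (by omega)).setReg i ?_⟩
    · have h1 := Nat.size_le.2 (hs.1 j)
      have h2 := Nat.size_le.2 (hs.1 k)
      simp only [Program.weight]; omega
    · have h1 := hs.1 j
      have h2 := hs.1 k
      simp only [Program.weight, pow_succ]; omega
  | sub i j k =>
    refine ⟨_, .sub i j k s, ?_, (hs.mono (by omega)).setReg i ?_⟩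
    · have h1 := Nat.size_le.2 (hs.1 j)
      have h2 := Nat.size_le.2 (hs.1 k)
      simp only [Program.weight]; omega
    · have h1 := hs.1 j
      simp only [Program.weight, pow_succ]; omega
  | load i j =>
    refine ⟨_, .load i j s, ?_, (hs.mono (by omega)).setReg i ?_⟩
    · have h1 := Nat.size_le.2 (hs.1 j)
      have h2 := Nat.size_le.2 (hs.2 (s.reg j))
      simp only [Program.weight]; omega
    · have h1 := hs.2 (s.reg j)
      simp only [Program.weight, pow_succ]; omega
  | store i j =>
    refine ⟨_, .store i j s, ?_, (hs.mono (by omega)).setMem _ ?_⟩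
    · have h1 := Nat.size_le.2 (hs.1 i)
      have h2 := Nat.size_le.2 (hs.1 j)
      simp only [Program.weight]; omega
    · have h1 := hs.1 j
      simp only [Program.weight, pow_succ]; omega
  | seq p q ihp ihq =>
    obtain ⟨t, h1, h2, h3⟩ := ihp hp.1 hs
    obtain ⟨t', h1', h2', h3'⟩ := ihq hp.2 h3
    refine ⟨_, h1.seq h1', ?_, h3'.mono (by simp only [Program.weight]; omega)⟩
    simp only [Program.weight, add_mul] at *
    refine Nat.add_le_add (h2.trans ?_) (h2'.trans ?_) <;> gcongr ?_ * ?_ <;> omega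
  | cond i p q ihp ihq =>
    have h0 := Nat.size_le.2 (hs.1 i)
    simp only [Program.eval]
    split_ifs with h
    · obtain ⟨t, h1, h2, h3⟩ := ihq hp.2 hs
      refine ⟨_, .cond_false h h1, ?_, h3.mono (by simp only [Program.weight]; omega)⟩
      simp only [Program.weight] at *
      nlinarith
    · obtain ⟨t, h1, h2, h3⟩ := ihp hp.1 hs
      refine ⟨_, .cond_true h h1, ?_, h3.mono (by simp only [Program.weight]; omega)⟩
      simp only [Program.weight] at *
      nlinarith
  | loop => exact hp.elim

/-- A bound on the cost of a program without loops. -/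
def Program.straightCost (p : Program) : ℕ := p.weight * (2 * p.weight + 1)

/-- Only the start state has to be bounded: the growth inside the program is absorbed by the
constant `straightCost`, which does not depend on `B`. -/
theorem Program.Straight.exec_eval {p : Program} (hp : p.Straight) {B : ℕ} {s s' : State}
    (hs : Bounded B s) (h : p.eval s = s') : Exec B p s s' p.straightCost := by
  obtain ⟨t, h1, h2, -⟩ := hp.runs_eval hs
  subst h
  refine ⟨t, h1, h2.trans ?_⟩
  rw [Program.straightCost, mul_assoc]
  exact Nat.mul_le_mul_left _ (by nlinarith [Nat.zero_le (B * p.weight)])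

/-! ### States with a list of registers and a memory in three parts -/

/-- A memory with the cells `inp` below `b`, the cells `Q` at even and the cells `C` at odd distance
from `b`. -/
def layout (inp : ℕ → ℕ) (b : ℕ) (Q C : ℕ → ℕ) (a : ℕ) : ℕ :=
  if a < b then inp a else if (a - b) % 2 = 0 then Q ((a - b) / 2) else C ((a - b) / 2)

/-- The state with registers `l` (followed by zeros) and memory `layout inp b Q C`. -/
def st (inp : ℕ → ℕ) (b : ℕ) (Q C : ℕ → ℕ) (l : List ℕ) : State :=
  ⟨fun i => l.getD i 0, layout inp b Q C⟩

variable {inp Q C : ℕ → ℕ} {b : ℕ}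

theorem st_reg (l : List ℕ) (i : ℕ) : (st inp b Q C l).reg i = l.getD i 0 := rfl

theorem st_mem (l : List ℕ) : (st inp b Q C l).mem = layout inp b Q C := rfl

theorem st_setReg {l : List ℕ} {i : ℕ} (x : ℕ) (h : i < l.length) :
    (st inp b Q C l).setReg i x = st inp b Q C (l.set i x) := by
  simp only [st, State.setReg, State.mk.injEq, and_true]
  funext j
  by_cases hj : j = i
  · subst hj; simp [h]
  · simp [Function.update_of_ne hj, List.getElem?_set_ne (Ne.symm hj)]

theorem layout_input {a : ℕ} (h : a < b) : layout inp b Q C a = inp a := if_pos h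

theorem layout_queue {a : ℕ} (j : ℕ) (h : a = b + 2 * j) : layout inp b Q C a = Q j := by
  subst h
  simp [layout]

theorem layout_count {a : ℕ} (w : ℕ) (h : a = b + 1 + w + w) : layout inp b Q C a = C w := by
  subst h
  rw [layout, if_neg (by omega), if_neg (by omega)]
  congr 1; omega

theorem st_setMem_queue {l : List ℕ} {a : ℕ} (j x : ℕ) (h : a = b + 2 * j) :
    (st inp b Q C l).setMem a x = st inp b (Function.update Q j x) C l := by
  subst h
  simp only [st, State.setMem, State.mk.injEq, true_and]
  funext a
  simp only [layout, Function.update_apply]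
  by_cases h1 : a < b
  · simp [h1, show a ≠ b + 2 * j by omega]
  · by_cases h2 : (a - b) % 2 = 0
    · simp only [h1, h2, if_true, if_false]
      refine if_congr ?_ rfl rfl
      omega
    · simp [h1, h2, show a ≠ b + 2 * j by omega]

theorem st_setMem_count {l : List ℕ} {a : ℕ} (w x : ℕ) (h : a = b + 1 + w + w) :
    (st inp b Q C l).setMem a x = st inp b Q (Function.update C w x) l := by
  subst h
  simp only [st, State.setMem, State.mk.injEq, true_and]
  funext a
  simp only [layout, Function.update_apply]
  by_cases h1 : a < b
  · simp [h1, show a ≠ b + 1 + w + w by omega]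
  · by_cases h2 : (a - b) % 2 = 0
    · simp [h1, h2, show a ≠ b + 1 + w + w by omega]
    · simp only [h1, h2, if_false]
      refine if_congr ?_ rfl rfl
      omega

theorem bounded_st {B : ℕ} {l : List ℕ} (hi : ∀ a, inp a < 2 ^ B) (hQ : ∀ a, Q a < 2 ^ B)
    (hC : ∀ a, C a < 2 ^ B) (hl : ∀ x ∈ l, x < 2 ^ B) : Bounded B (st inp b Q C l) := by
  refine ⟨fun i => ?_, fun a => ?_⟩
  · rw [st_reg, List.getD_eq_getElem?_getD]
    cases h : l[i]? with
    | none => simp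
    | some x => exact hl x (List.mem_of_getElem? h)
  · rw [st_mem, layout]
    split_ifs
    exacts [hi _, hQ _, hC _]

end RAM

namespace OrthogonalVectors

open RAM

/-! ### The program and its loop-free parts -/

/-- The registers: the number `n` of vectors, their length `d`, the end `b` of the input, the
constant `1`, the position `x` in the input, the number `i` of vectors to be read, the positions
`p` and `q` of the front and of the end of the queue, the number `r` of bits to be read, the end `e`
of a level of the queue, four registers for intermediate results, and two totals. -/
abbrev regs (n d b x i p q r e w g h c pos neg : ℕ) : List ℕ :=
  [n, d, b, 1, x, i, p, q, r, e, w, g, h, c, pos, neg]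

/-- Add `2` to a register. -/
def advance (i : ℕ) : Program := .seq (.add i i 3) (.add i i 3)

/-- Append to the queue the numbers that arise when the digits of a list are added to register
`10`, with signs relative to register `11`. -/
def emit : List (ℕ × Bool) → Program
  | [] => .skip
  | k :: G => .seq (.const 13 k.1) (.seq (.add 13 13 10) (.seq (.store 7 13) (.seq (advance 7)
      (.seq (.store 7 (if k.2 then 12 else 11)) (.seq (advance 7) (.seq (.const 13 0)
        (emit G)))))))

/-- Add register `13` to register `10` the given number of times. -/
def addTimes : ℕ → Program
  | 0 => .skip
  | K + 1 => .seq (.add 10 10 13) (addTimes K)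

/-- Take a node from the queue and append its children to the queue. -/
def expandNode (K : ℕ) (G : List (ℕ × Bool)) : Program :=
  .seq (.load 13 6) (.seq (advance 6) (.seq (.load 11 6) (.seq (advance 6) (.seq (.sub 12 3 11)
    (.seq (addTimes K) (.seq (.const 13 0) (.seq (emit G) (.seq (.const 10 0) (.seq (.const 11 0)
      (.seq (.const 12 0) (.sub 13 9 6)))))))))))

/-- Read the next bit of the row into register `13`, or `0` at the end of the row. -/
def readBit : Program :=
  .cond 8 (.seq (.load 13 4) (.seq (.add 4 4 3) (.sub 8 8 3))) (.const 13 0)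

/-- Take a left leaf from the queue and count it. -/
def countLeaf : Program :=
  .seq (.load 10 6) (.seq (advance 6) (.seq (advance 6) (.seq (.add 13 2 3) (.seq (.add 13 13 10)
    (.seq (.add 13 13 10) (.seq (.load 11 13) (.seq (.add 11 11 3) (.seq (.store 13 11)
      (.seq (.const 10 0) (.seq (.const 11 0) (.sub 13 7 6)))))))))))

/-- Take a right leaf from the queue and add the number of equal left leaves to one of the totals. -/
def lookupLeaf : Program :=
  .seq (.load 10 6) (.seq (advance 6) (.seq (.load 11 6) (.seq (advance 6) (.seq (.add 13 2 3)
    (.seq (.add 13 13 10) (.seq (.add 13 13 10) (.seq (.load 12 13)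
      (.seq (.cond 11 (.add 15 15 12) (.add 14 14 12))
        (.seq (.const 10 0) (.seq (.const 11 0) (.seq (.const 12 0) (.sub 13 7 6))))))))))))

/-- Start a queue with the node `0`. -/
def startQueue : Program :=
  .seq (.add 6 2 13) (.seq (.add 7 2 13) (.seq (.store 7 13) (.seq (advance 7) (.seq (.store 7 13)
    (.seq (advance 7) (.add 8 1 13))))))

/-! ### Lists of nodes in the queue -/

/-- The queue after a list of nodes is written at position `j`. -/
def writeNodes (Q : ℕ → ℕ) (j : ℕ) : List (ℕ × Bool) → ℕ → ℕ
  | [] => Q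
  | a :: A => writeNodes (Function.update (Function.update Q j a.1) (j + 1) a.2.toNat) (j + 2) A

/-- The list of nodes is in the queue at position `j`. -/
def Holds (Q : ℕ → ℕ) (j : ℕ) : List (ℕ × Bool) → Prop
  | [] => True
  | a :: A => Q j = a.1 ∧ Q (j + 1) = a.2.toNat ∧ Holds Q (j + 2) A

theorem writeNodes_of_lt {Q : ℕ → ℕ} {j i : ℕ} (A : List (ℕ × Bool)) (h : i < j) :
    writeNodes Q j A i = Q i := by
  induction A generalizing Q j with
  | nil => rfl
  | cons a A ih =>
    rw [writeNodes, ih (by omega), Function.update_of_ne (by omega),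
      Function.update_of_ne (by omega)]

theorem holds_writeNodes (Q : ℕ → ℕ) (j : ℕ) (A : List (ℕ × Bool)) :
    Holds (writeNodes Q j A) j A := by
  induction A generalizing Q j with
  | nil => trivial
  | cons a A ih =>
    refine ⟨?_, ?_, ih _ _⟩
    · rw [writeNodes, writeNodes_of_lt _ (by omega), Function.update_of_ne (by omega),
        Function.update_self]
    · rw [writeNodes, writeNodes_of_lt _ (by omega), Function.update_self]

theorem writeNodes_append (Q : ℕ → ℕ) (j : ℕ) (A A' : List (ℕ × Bool)) :
    writeNodes Q j (A ++ A') = writeNodes (writeNodes Q j A) (j + 2 * A.length) A' := by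
  induction A generalizing Q j with
  | nil => rfl
  | cons a A ih =>
    simp only [List.cons_append, writeNodes, ih, List.length_cons]
    congr 1; ring

theorem writeNodes_lt {Q : ℕ → ℕ} {j X : ℕ} {A : List (ℕ × Bool)} (hQ : ∀ i, Q i < X)
    (hA : ∀ a ∈ A, a.1 < X) (hX : 1 < X) (i : ℕ) : writeNodes Q j A i < X := by
  induction A generalizing Q j with
  | nil => exact hQ i
  | cons a A ih =>
    refine ih (fun i => ?_) (fun c hc => hA c (List.mem_cons_of_mem _ hc))
    simp only [Function.update_apply]
    split_ifs
    · exact (Bool.toNat_le _).trans_lt hX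
    · exact hA a List.mem_cons_self
    · exact hQ i

theorem Holds.congr {Q Q' : ℕ → ℕ} {j : ℕ} {A : List (ℕ × Bool)} (h : Holds Q j A)
    (hQ : ∀ i < j + 2 * A.length, Q' i = Q i) : Holds Q' j A := by
  induction A generalizing j with
  | nil => trivial
  | cons a A ih =>
    simp only [List.length_cons] at hQ
    refine ⟨?_, ?_, ih h.2.2 fun i hi => hQ i (by omega)⟩
    · rw [hQ _ (by omega)]; exact h.1
    · rw [hQ _ (by omega)]; exact h.2.1

variable {inp Q C : ℕ → ℕ} {n d b x i p q r e w g h c pos neg : ℕ}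

/-! ### The effect of the loop-free parts -/

/-- Register `12` holds the complement of the sign in register `11`. Selecting one of the two in the
program text realizes the exclusive or of the signs without a test. -/
theorem eval_emit (K v j : ℕ) (s : Bool) (G : List (ℕ × Bool)) :
    (emit G).eval (st inp b Q C
      (regs n d b x i p (b + 2 * j) r e (K * v) s.toNat (!s).toNat 0 pos neg)) =
    st inp b (writeNodes Q j (appendDigits K (v, s) G)) C
      (regs n d b x i p (b + 2 * (j + 2 * G.length)) r e (K * v) s.toNat (!s).toNat 0 pos neg) := by
  induction G generalizing Q j with
  | nil => rfl
  | cons k G ih =>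
    have e1 : b + 2 * j + 1 + 1 = b + 2 * (j + 1) := by ring
    have e2 : b + 2 * (j + 1) + 1 + 1 = b + 2 * (j + 2) := by ring
    rcases k with ⟨k, t⟩
    have e3 : ∀ m : ℕ, j + 2 + 2 * m = j + 2 * (m + 1) := fun m => by ring
    cases t <;>
    simp only [emit, advance, Program.eval, st_reg, st_setReg, List.getD_cons_succ, List.getD_cons_zero,
      List.set_cons_succ, List.set_cons_zero, List.length_cons, List.length_nil, Nat.reduceAdd,
      Nat.reduceLT, st_setMem_queue _ _ rfl, e1, e2, Bool.false_eq_true, if_false, if_true] <;>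
    rw [ih] <;>
    simp [appendDigits, writeNodes, e3, Nat.add_comm k (K * v)]

theorem eval_addTimes (K : ℕ) :
    (addTimes K).eval (st inp b Q C (regs n d b x i p q r e w g h c pos neg)) =
      st inp b Q C (regs n d b x i p q r e (w + K * c) g h c pos neg) := by
  induction K generalizing w with
  | zero => simp [addTimes, Program.eval]
  | succ K ih =>
    simp only [addTimes, Program.eval, st_reg, st_setReg, List.getD_cons_succ, List.getD_cons_zero,
      List.set_cons_succ, List.set_cons_zero, List.length_cons, List.length_nil, Nat.reduceAdd,
      Nat.reduceLT]
    rw [ih]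
    congr 2; ring

/-- Multiplication by the constant `K` is `K` additions. The scratch registers are cleared so that
every round starts from a state of the same form, and register `13` receives the distance to the end
of the level, which controls the loop. -/
theorem eval_expandNode (K P j E : ℕ) (a : ℕ × Bool) (G : List (ℕ × Bool)) (h1 : Q P = a.1)
    (h2 : Q (P + 1) = a.2.toNat) :
    (expandNode K G).eval (st inp b Q C
      (regs n d b x i (b + 2 * P) (b + 2 * j) r (b + 2 * E) 0 0 0 c pos neg)) =
    st inp b (writeNodes Q j (appendDigits K a G)) C
      (regs n d b x i (b + 2 * (P + 2)) (b + 2 * (j + 2 * G.length)) r (b + 2 * E) 0 0 0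
        (b + 2 * E - (b + 2 * (P + 2))) pos neg) := by
  have e1 : b + 2 * P + 1 + 1 = b + 2 * (P + 1) := by ring
  have e2 : b + 2 * (P + 1) + 1 + 1 = b + 2 * (P + 2) := by ring
  have e3 : 1 - a.2.toNat = (!a.2).toNat := by cases a.2 <;> rfl
  simp only [expandNode, advance, Program.eval, st_reg, st_setReg, List.getD_cons_succ, List.getD_cons_zero,
      List.set_cons_succ, List.set_cons_zero, List.length_cons, List.length_nil, Nat.reduceAdd,
      Nat.reduceLT, st_mem, layout_queue _ rfl, e1, e2, h1, h2, e3,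
    eval_addTimes, Nat.zero_add]
  rw [eval_emit]
  simp only [st_reg, st_setReg, List.getD_cons_succ, List.getD_cons_zero,
      List.set_cons_succ, List.set_cons_zero, List.length_cons, List.length_nil, Nat.reduceAdd,
      Nat.reduceLT]

theorem eval_readBit_of_pos (hr : r ≠ 0) (hx : x < b) :
    readBit.eval (st inp b Q C (regs n d b x i p q r e w g h c pos neg)) =
      st inp b Q C (regs n d b (x + 1) i p q (r - 1) e w g h (inp x) pos neg) := by
  simp only [readBit, Program.eval, st_reg, st_setReg, List.getD_cons_succ, List.getD_cons_zero,
      List.set_cons_succ, List.set_cons_zero, List.length_cons, List.length_nil, Nat.reduceAdd,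
      Nat.reduceLT, st_mem, layout_input hx, hr, if_false]

theorem eval_readBit_zero :
    readBit.eval (st inp b Q C (regs n d b x i p q 0 e w g h c pos neg)) =
      st inp b Q C (regs n d b x i p q 0 e w g h 0 pos neg) := by
  simp only [readBit, Program.eval, st_reg, st_setReg, List.getD_cons_succ, List.getD_cons_zero,
      List.set_cons_succ, List.set_cons_zero, List.length_cons, List.length_nil, Nat.reduceAdd,
      Nat.reduceLT, if_true]

theorem eval_countLeaf (P j : ℕ) (a : ℕ × Bool) (h1 : Q P = a.1) :
    countLeaf.eval (st inp b Q C
      (regs n d b x i (b + 2 * P) (b + 2 * j) r e 0 0 h c pos neg)) =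
    st inp b Q (Function.update C a.1 (C a.1 + 1))
      (regs n d b x i (b + 2 * (P + 2)) (b + 2 * j) r e 0 0 h (b + 2 * j - (b + 2 * (P + 2)))
        pos neg) := by
  have e1 : b + 2 * P + 1 + 1 + 1 + 1 = b + 2 * (P + 2) := by ring
  simp only [countLeaf, advance, Program.eval, st_reg, st_setReg, List.getD_cons_succ, List.getD_cons_zero,
      List.set_cons_succ, List.set_cons_zero, List.length_cons, List.length_nil, Nat.reduceAdd,
      Nat.reduceLT, st_mem, layout_queue _ rfl, e1, h1, layout_count _ rfl,
    st_setMem_count _ _ rfl]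

theorem eval_lookupLeaf (P j : ℕ) (a : ℕ × Bool) (h1 : Q P = a.1) (h2 : Q (P + 1) = a.2.toNat) :
    lookupLeaf.eval (st inp b Q C
      (regs n d b x i (b + 2 * P) (b + 2 * j) r e 0 0 0 c pos neg)) =
    st inp b Q C
      (regs n d b x i (b + 2 * (P + 2)) (b + 2 * j) r e 0 0 0 (b + 2 * j - (b + 2 * (P + 2)))
        (pos + if a.2 then 0 else C a.1) (neg + if a.2 then C a.1 else 0)) := by
  have e1 : b + 2 * P + 1 + 1 = b + 2 * (P + 1) := by ring
  have e2 : b + 2 * (P + 1) + 1 + 1 = b + 2 * (P + 2) := by ring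
  rcases a with ⟨k, t⟩
  simp only at h1 h2
  cases t <;>
  simp only [lookupLeaf, advance, Program.eval, st_reg, st_setReg, List.getD_cons_succ, List.getD_cons_zero,
      List.set_cons_succ, List.set_cons_zero, List.length_cons, List.length_nil, Nat.reduceAdd,
      Nat.reduceLT, st_mem, layout_queue _ rfl, e1, e2, h1, h2,
    layout_count _ rfl, Bool.toNat_false, Bool.toNat_true, if_true, one_ne_zero, if_false,
    Bool.false_eq_true, Nat.add_zero]

theorem eval_startQueue :
    startQueue.eval (st inp b Q C (regs n d b x i p q r e w g h 0 pos neg)) =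
      st inp b (writeNodes Q 0 [(0, false)]) C
        (regs n d b x i b (b + 2 * 2) d e w g h 0 pos neg) := by
  have e1 : b + 1 + 1 = b + 2 * 1 := by ring
  have e2 : b + 2 * 1 + 1 + 1 = b + 2 * 2 := by ring
  simp only [startQueue, advance, Program.eval, st_reg, st_setReg, List.getD_cons_succ, List.getD_cons_zero,
      List.set_cons_succ, List.set_cons_zero, List.length_cons, List.length_nil, Nat.reduceAdd,
      Nat.reduceLT, e1, e2, Nat.add_zero,
    st_setMem_queue 0 _ (Nat.add_zero b).symm, st_setMem_queue 1 _ rfl]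
  rfl

theorem straight_emit (G : List (ℕ × Bool)) : (emit G).Straight := by
  induction G with
  | nil => trivial
  | cons k G ih => simpa [emit, advance, Program.Straight] using ih

theorem straight_addTimes (K : ℕ) : (addTimes K).Straight := by
  induction K with
  | zero => trivial
  | succ K ih => simpa [addTimes, Program.Straight] using ih

theorem straight_expandNode (K : ℕ) (G : List (ℕ × Bool)) : (expandNode K G).Straight := by
  simp [expandNode, advance, Program.Straight, straight_emit, straight_addTimes]

theorem straight_readBit : readBit.Straight := by
  simp [readBit, Program.Straight]

theorem straight_countLeaf : countLeaf.Straight := by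
  simp [countLeaf, advance, Program.Straight]

theorem straight_lookupLeaf : lookupLeaf.Straight := by
  simp [lookupLeaf, advance, Program.Straight]

theorem straight_startQueue : startQueue.Straight := by
  simp [startQueue, advance, Program.Straight]

/-! ### Loops over the queue -/

/-- Children are written from `j` on, beyond the end `E` of the current level, so the unread nodes
remain intact. -/
theorem exec_expandNodes {B K P j E : ℕ} {G A : List (ℕ × Bool)}
    (hinp : ∀ a, inp a < 2 ^ B) (hQ : ∀ a, Q a < 2 ^ B) (hC : ∀ a, C a < 2 ^ B)
    (hregs : ∀ z ∈ [n, d, b, 1, x, i, r, pos, neg], z < 2 ^ B) (hA : Holds Q P A)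
    (hE : P + 2 * A.length = E) (hj : E ≤ j)
    (hend : b + 2 * (j + 2 * (A.flatMap fun a => appendDigits K a G).length) < 2 ^ B)
    (hkeys : ∀ a ∈ A.flatMap fun a => appendDigits K a G, a.1 < 2 ^ B) :
    Exec B (.loop 13 (expandNode K G))
      (st inp b Q C (regs n d b x i (b + 2 * P) (b + 2 * j) r (b + 2 * E) 0 0 0
        (b + 2 * E - (b + 2 * P)) pos neg))
      (st inp b (writeNodes Q j (A.flatMap fun a => appendDigits K a G)) C
        (regs n d b x i (b + 2 * E)
          (b + 2 * (j + 2 * (A.flatMap fun a => appendDigits K a G).length)) r (b + 2 * E) 0 0 0 0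
          pos neg))
      (A.length * ((expandNode K G).straightCost + 1) + 1) := by
  have hregs' := hregs
  simp only [List.mem_cons, List.not_mem_nil, or_false, forall_eq_or_imp, forall_eq] at hregs'
  induction A generalizing Q P j with
  | nil =>
    simp only [List.length_nil, Nat.mul_zero, Nat.add_zero] at hE
    subst hE
    simp only [List.flatMap_nil, List.length_nil, Nat.mul_zero, Nat.add_zero, Nat.sub_self,
      writeNodes, Nat.zero_mul, Nat.zero_add]
    exact Exec.loop_done rfl
  | cons a A ih =>
    obtain ⟨h1, h2, h3⟩ := hA
    simp only [List.flatMap_cons, List.length_append, List.length_cons, writeNodes_append] at *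
    have hlen : (appendDigits K a G).length = G.length := by simp [appendDigits]
    rw [hlen] at hend ⊢
    have hB : Bounded B (st inp b Q C (regs n d b x i (b + 2 * P) (b + 2 * j) r (b + 2 * E) 0 0 0
        (b + 2 * E - (b + 2 * P)) pos neg)) := by
      refine bounded_st hinp hQ hC ?_
      simp only [List.mem_cons, List.not_mem_nil, or_false, forall_eq_or_imp, forall_eq]
      omega
    have hstep := (straight_expandNode K G).exec_eval hB (eval_expandNode K P j E a G h1 h2)
    have hrest := ih (Q := writeNodes Q j (appendDigits K a G)) (P := P + 2)
      (j := j + 2 * G.length)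
      (writeNodes_lt hQ (fun a ha => hkeys a (List.mem_append_left _ ha)) hregs'.2.2.2.1)
      (h3.congr fun i hi => writeNodes_of_lt _ (by omega)) (by omega) (by omega) (by omega)
      (fun a ha => hkeys a (List.mem_append_right _ ha))
    have h13 : b + 2 * E - (b + 2 * P) ≠ 0 := by omega
    have h13' : b + 2 * E - (b + 2 * P) < 2 ^ B := by omega
    have hall := hstep.loop_step (i := 13) h13 h13' hrest
    rw [show j + 2 * (G.length + (A.flatMap fun a => appendDigits K a G).length) =
      j + 2 * G.length + 2 * (A.flatMap fun a => appendDigits K a G).length by ring]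
    exact hall.mono (by rw [Nat.succ_mul]; omega)

theorem exec_countLeaves {B P j : ℕ} {A : List (ℕ × Bool)}
    (hinp : ∀ a, inp a < 2 ^ B) (hQ : ∀ a, Q a < 2 ^ B) (hC : ∀ a, C a + A.length < 2 ^ B)
    (hregs : ∀ z ∈ [n, d, b, 1, x, i, r, pos, neg, b + 2 * j], z < 2 ^ B) (hA : Holds Q P A)
    (hj : P + 2 * A.length = j) :
    Exec B (.loop 13 countLeaf)
      (st inp b Q C (regs n d b x i (b + 2 * P) (b + 2 * j) r 0 0 0 0
        (b + 2 * j - (b + 2 * P)) pos neg))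
      (st inp b Q (fun a => C a + (A.map Prod.fst).count a)
        (regs n d b x i (b + 2 * j) (b + 2 * j) r 0 0 0 0 0 pos neg))
      (A.length * (countLeaf.straightCost + 1) + 1) := by
  have hregs' := hregs
  simp only [List.mem_cons, List.not_mem_nil, or_false, forall_eq_or_imp, forall_eq] at hregs'
  induction A generalizing C P with
  | nil =>
    simp only [List.length_nil, Nat.mul_zero, Nat.add_zero] at hj
    subst hj
    simp only [List.map_nil, List.count_nil, List.length_nil, Nat.add_zero, Nat.sub_self,
      Nat.zero_mul, Nat.zero_add]
    exact Exec.loop_done rfl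
  | cons a A ih =>
    obtain ⟨h1, h2, h3⟩ := hA
    simp only [List.length_cons] at *
    have hB : Bounded B (st inp b Q C (regs n d b x i (b + 2 * P) (b + 2 * j) r 0 0 0 0
        (b + 2 * j - (b + 2 * P)) pos neg)) := by
      refine bounded_st hinp hQ (fun a => by have := hC a; omega) ?_
      simp only [List.mem_cons, List.not_mem_nil, or_false, forall_eq_or_imp, forall_eq]
      omega
    have hstep := straight_countLeaf.exec_eval hB (eval_countLeaf P j a h1)
    have hrest := ih (C := Function.update C a.1 (C a.1 + 1)) (P := P + 2)
      (fun k => by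
        have := hC k
        have := hC a.1
        simp only [Function.update_apply]
        split_ifs <;> omega) h3 (by omega)
    have h13 : b + 2 * j - (b + 2 * P) ≠ 0 := by omega
    have h13' : b + 2 * j - (b + 2 * P) < 2 ^ B := by omega
    have hall := hstep.loop_step (i := 13) h13 h13' hrest
    have e : (fun k => Function.update C a.1 (C a.1 + 1) k + (A.map Prod.fst).count k) =
        fun k => C k + ((a :: A).map Prod.fst).count k := by
      funext k
      simp only [Function.update_apply, List.map_cons, List.count_cons]
      by_cases hk : k = a.1
      · simp [hk]; ring
      · simp [hk, Ne.symm hk]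
    rw [e] at hall
    exact hall.mono (by rw [Nat.succ_mul]; omega)

theorem exec_lookupLeaves {B P j X : ℕ} {A : List (ℕ × Bool)}
    (hinp : ∀ a, inp a < 2 ^ B) (hQ : ∀ a, Q a < 2 ^ B) (hC : ∀ a, C a < 2 ^ B)
    (hX : ∀ a, C a ≤ X) (hpos : pos + A.length * X < 2 ^ B) (hneg : neg + A.length * X < 2 ^ B)
    (hregs : ∀ z ∈ [n, d, b, 1, x, i, r, b + 2 * j], z < 2 ^ B) (hA : Holds Q P A)
    (hj : P + 2 * A.length = j) :
    Exec B (.loop 13 lookupLeaf)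
      (st inp b Q C (regs n d b x i (b + 2 * P) (b + 2 * j) r 0 0 0 0
        (b + 2 * j - (b + 2 * P)) pos neg))
      (st inp b Q C
        (regs n d b x i (b + 2 * j) (b + 2 * j) r 0 0 0 0 0
          (pos + (A.map fun a => if a.2 then 0 else C a.1).sum)
          (neg + (A.map fun a => if a.2 then C a.1 else 0).sum)))
      (A.length * (lookupLeaf.straightCost + 1) + 1) := by
  have hregs' := hregs
  simp only [List.mem_cons, List.not_mem_nil, or_false, forall_eq_or_imp, forall_eq] at hregs'
  induction A generalizing pos neg P with
  | nil =>
    simp only [List.length_nil, Nat.mul_zero, Nat.add_zero] at hj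
    subst hj
    simp only [List.map_nil, List.sum_nil, List.length_nil, Nat.add_zero, Nat.sub_self,
      Nat.zero_mul, Nat.zero_add]
    exact Exec.loop_done rfl
  | cons a A ih =>
    obtain ⟨h1, h2, h3⟩ := hA
    simp only [List.length_cons] at *
    rw [Nat.succ_mul] at hpos hneg
    have hB : Bounded B (st inp b Q C (regs n d b x i (b + 2 * P) (b + 2 * j) r 0 0 0 0
        (b + 2 * j - (b + 2 * P)) pos neg)) := by
      refine bounded_st hinp hQ hC ?_
      simp only [List.mem_cons, List.not_mem_nil, or_false, forall_eq_or_imp, forall_eq]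
      omega
    have hstep := straight_lookupLeaf.exec_eval hB (eval_lookupLeaf P j a h1 h2)
    have hXa := hX a.1
    have hrest := ih (pos := pos + if a.2 then 0 else C a.1) (neg := neg + if a.2 then C a.1 else 0)
      (P := P + 2) (by split_ifs <;> omega) (by split_ifs <;> omega) h3 (by omega)
    have h13 : b + 2 * j - (b + 2 * P) ≠ 0 := by omega
    have h13' : b + 2 * j - (b + 2 * P) < 2 ^ B := by omega
    have hall := hstep.loop_step (i := 13) h13 h13' hrest
    simp only [List.map_cons, List.sum_cons, ← Nat.add_assoc]
    exact hall.mono (by rw [Nat.succ_mul]; omega)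

/-! ### Expanding a row -/

/-- Read bits and continue with the program for the bits that were read. -/
def branch (cont : List Bool → Program) : ℕ → List Bool → Program
  | 0, l => cont l
  | k + 1, l => .seq readBit (.cond 13 (.seq (.const 13 0) (branch cont k (true :: l)))
      (branch cont k (false :: l)))

/-- A bound on the cost of reading a bit and branching. -/
def branchCost : ℕ := readBit.straightCost + (Program.const 13 0).straightCost + 1

/-- The program is a binary tree with one copy of `cont` for each string of `k` further bits, so the
list `F l` can be a constant of the program text. New bits go to the head of the list, hence the
reversed order. Past the end of the row zeros are read, which leaves disjointness unchanged. -/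
theorem exec_branch {B t x₀ k m : ℕ} {f : ℕ → Bool} {cont : List Bool → Program} {s' : State}
    (hinp : ∀ a, inp a < 2 ^ B) (hQ : ∀ a, Q a < 2 ^ B) (hC : ∀ a, C a < 2 ^ B)
    (hregs : ∀ z ∈ [n, d, b, 1, i, p, q, e, w, g, h, pos, neg], z < 2 ^ B)
    (hf : ∀ i < d, inp (x₀ + i) = (f i).toNat) (hf' : ∀ i, d ≤ i → f i = false) (hb : x₀ + d ≤ b)
    (hcont : Exec B (cont (revBits (fun i => f (t + i)) (m + k)))
      (st inp b Q C (regs n d b (x₀ + min (t + (m + k)) d) i p q (d - (t + (m + k))) e w g h 0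
        pos neg)) s' c) :
    Exec B (branch cont k (revBits (fun i => f (t + i)) m))
      (st inp b Q C (regs n d b (x₀ + min (t + m) d) i p q (d - (t + m)) e w g h 0 pos neg)) s'
      (k * branchCost + c) := by
  have hregs' := hregs
  simp only [List.mem_cons, List.not_mem_nil, or_false, forall_eq_or_imp, forall_eq] at hregs'
  induction k generalizing m with
  | zero => simpa [branch] using hcont
  | succ k ih =>
    have hrest := ih (m := m + 1) (by rwa [show m + 1 + k = m + (k + 1) by ring])
    have hbit : f (t + m) = true → t + m < d := fun hb => by
      by_contra hd
      rw [hf' _ (by omega)] at hb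
      exact Bool.false_ne_true hb
    have hB : ∀ y, y < 2 ^ B → Bounded B (st inp b Q C
        (regs n d b (x₀ + min (t + m) d) i p q (d - (t + m)) e w g h y pos neg)) := by
      intro y hy
      refine bounded_st hinp hQ hC ?_
      simp only [List.mem_cons, List.not_mem_nil, or_false, forall_eq_or_imp, forall_eq]
      omega
    have hB' : Bounded B (st inp b Q C (regs n d b (x₀ + min (t + (m + 1)) d) i p q
        (d - (t + (m + 1))) e w g h (f (t + m)).toNat pos neg)) := by
      have := Bool.toNat_le (f (t + m))
      refine bounded_st hinp hQ hC ?_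
      simp only [List.mem_cons, List.not_mem_nil, or_false, forall_eq_or_imp, forall_eq]
      omega
    have hread : Exec B readBit (st inp b Q C (regs n d b (x₀ + min (t + m) d) i p q (d - (t + m))
        e w g h 0 pos neg)) (st inp b Q C (regs n d b (x₀ + min (t + (m + 1)) d) i p q
        (d - (t + (m + 1))) e w g h (f (t + m)).toNat pos neg)) readBit.straightCost := by
      refine straight_readBit.exec_eval (hB 0 (by positivity)) ?_
      rcases Nat.lt_or_ge (t + m) d with hd | hd
      · rw [eval_readBit_of_pos (by omega) (by omega), min_eq_left hd.le,
          min_eq_left (show t + (m + 1) ≤ d by omega), hf _ hd,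
          show d - (t + m) - 1 = d - (t + (m + 1)) by omega]
        rfl
      · rw [min_eq_right hd, min_eq_right (show d ≤ t + (m + 1) by omega),
          show d - (t + m) = 0 by omega, show d - (t + (m + 1)) = 0 by omega, eval_readBit_zero,
          hf' _ hd]
        rfl
    rw [revBits] at hrest
    rw [branch]
    cases hfb : f (t + m) with
    | false =>
      rw [hfb] at hread hrest
      refine (hread.seq (Exec.cond_false rfl hrest)).mono ?_
      rw [Nat.succ_mul, branchCost]; omega
    | true =>
      rw [hfb] at hread hrest hB'
      have hz : Exec B (.const 13 0) _ _ _ :=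
        Program.Straight.exec_eval (p := .const 13 0) trivial hB' (st_setReg 0 (by simp))
      refine (hread.seq (Exec.cond_true (by simp [st_reg])
        (by simpa [st_reg] using hregs'.2.2.2.1) (hz.seq hrest))).mono ?_
      rw [Nat.succ_mul, branchCost]; omega

/-- Read a block of bits and replace the nodes of the queue by their children. -/
def expandLevel (K κ : ℕ) (F : List Bool → List (ℕ × Bool)) : Program :=
  .seq (.add 9 7 13) (branch (fun l => .seq (.sub 13 9 6) (.seq (.loop 13 (expandNode K (F l)))
    (.const 9 0))) κ [])

theorem exec_expandLevel {B K κ P j t x₀ N : ℕ} {f : ℕ → Bool} {F : List Bool → List (ℕ × Bool)}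
    {A A' : List (ℕ × Bool)} (hinp : ∀ a, inp a < 2 ^ B) (hQ : ∀ a, Q a < 2 ^ B)
    (hC : ∀ a, C a < 2 ^ B) (hregs : ∀ z ∈ [n, d, b, 1, i, pos, neg], z < 2 ^ B)
    (hf : ∀ i < d, inp (x₀ + i) = (f i).toNat) (hf' : ∀ i, d ≤ i → f i = false) (hb : x₀ + d ≤ b)
    (hA : Holds Q P A) (hj : P + 2 * A.length = j)
    (hA' : (A.flatMap fun a => appendDigits K a (F (revBits (fun i => f (t + i)) κ))) = A')
    (hend : b + 2 * (j + 2 * A'.length) < 2 ^ B) (hkeys : ∀ a ∈ A', a.1 < 2 ^ B)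
    (hN : (expandNode K (F (revBits (fun i => f (t + i)) κ))).straightCost ≤ N) :
    Exec B (expandLevel K κ F)
      (st inp b Q C
        (regs n d b (x₀ + min t d) i (b + 2 * P) (b + 2 * j) (d - t) 0 0 0 0 0 pos neg))
      (st inp b (writeNodes Q j A') C
        (regs n d b (x₀ + min (t + κ) d) i (b + 2 * j) (b + 2 * (j + 2 * A'.length)) (d - (t + κ))
          0 0 0 0 0 pos neg)) (κ * branchCost + A.length * (N + 1) + 10) := by
  have hregs' := hregs
  simp only [List.mem_cons, List.not_mem_nil, or_false, forall_eq_or_imp, forall_eq] at hregs'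
  have hB : ∀ (Q' : ℕ → ℕ) (x p q r e c : ℕ), (∀ a, Q' a < 2 ^ B) → x ≤ b → p < 2 ^ B →
      q < 2 ^ B → r ≤ d → e < 2 ^ B → c < 2 ^ B →
      Bounded B (st inp b Q' C (regs n d b x i p q r e 0 0 0 c pos neg)) := by
    intro Q' x p q r e c hQ' _ _ _ _ _ _
    refine bounded_st hinp hQ' hC ?_
    simp only [List.mem_cons, List.not_mem_nil, or_false, forall_eq_or_imp, forall_eq]
    omega
  have h1 : Exec B (.add 9 7 13) _ _ _ := Program.Straight.exec_eval (p := .add 9 7 13) trivial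
    (hB Q (x₀ + min t d) (b + 2 * P) (b + 2 * j) (d - t) 0 0 hQ (by omega) (by omega) (by omega)
      (by omega) (by omega) (by omega)) (st_setReg _ (by simp))
  have h2 : Exec B (.sub 13 9 6) _ _ _ := Program.Straight.exec_eval (p := .sub 13 9 6) trivial
    (hB Q (x₀ + min (t + κ) d) (b + 2 * P) (b + 2 * j) (d - (t + κ)) (b + 2 * j) 0 hQ (by omega)
      (by omega) (by omega) (by omega) (by omega) (by omega)) (st_setReg _ (by simp))
  have h3 := exec_expandNodes (b := b) (n := n) (d := d) (x := x₀ + min (t + κ) d) (i := i)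
    (r := d - (t + κ)) (pos := pos) (neg := neg) (j := j) hinp hQ hC
    (by
      simp only [List.mem_cons, List.not_mem_nil, or_false, forall_eq_or_imp, forall_eq]
      omega) hA hj le_rfl (by rw [hA']; exact hend) (by rw [hA']; exact hkeys)
  rw [hA'] at h3
  have h4 : Exec B (.const 9 0) _ _ _ := Program.Straight.exec_eval (p := .const 9 0) trivial
    (hB (writeNodes Q j A') (x₀ + min (t + κ) d) (b + 2 * j) (b + 2 * (j + 2 * A'.length))
      (d - (t + κ)) (b + 2 * j) 0 (writeNodes_lt hQ hkeys hregs'.2.2.2.1) (by omega) (by omega)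
      (by omega) (by omega) (by omega) (by omega)) (st_setReg _ (by simp))
  have h5 := exec_branch (n := n) (d := d) (i := i) (p := b + 2 * P) (q := b + 2 * j)
    (e := b + 2 * j) (w := 0) (g := 0) (h := 0) (pos := pos) (neg := neg) (t := t) (m := 0)
    (k := κ) (cont := fun l => .seq (.sub 13 9 6) (.seq (.loop 13 (expandNode K (F l)))
      (.const 9 0))) hinp hQ hC
    (by
      simp only [List.mem_cons, List.not_mem_nil, or_false, forall_eq_or_imp, forall_eq]
      omega) hf hf' hb (by rw [Nat.zero_add]; exact h2.seq (h3.seq h4))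
  refine (h1.seq h5).mono ?_
  have e1 : ∀ i j k, (Program.add i j k).straightCost = 3 := fun _ _ _ => rfl
  have e2 : ∀ i j k, (Program.sub i j k).straightCost = 3 := fun _ _ _ => rfl
  have e3 : ∀ i, (Program.const i 0).straightCost = 3 := fun _ => by
    simp [Program.straightCost, Program.weight]
  have := Nat.mul_le_mul_left A.length (Nat.succ_le_succ hN)
  simp only [Nat.succ_eq_add_one] at this
  rw [e1, e2, e3]
  omega

/-- Put the leaves of a row of bits into the queue. -/
def expandRow (K κ : ℕ) (F : List Bool → List (ℕ × Bool)) : Program :=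
  .seq startQueue (.loop 8 (expandLevel K κ F))

/-- A bound on the cost of `expandRow`. -/
def expandRowCost (κ N D M : ℕ) : ℕ :=
  startQueue.straightCost + (D * (κ * branchCost + M * (N + 1) + 11) + 1)

/-- By `hD` and `hD'`, the number of unread bits is positive before each of the `D` levels and zero
after them, so register `8` ends the loop after exactly `D` rounds. -/
theorem exec_expandRow {B K κ x₀ N D M : ℕ} {f : ℕ → Bool} {F : List Bool → List (ℕ × Bool)}
    (hinp : ∀ a, inp a < 2 ^ B) (hQ : ∀ a, Q a < 2 ^ B)
    (hC : ∀ a, C a < 2 ^ B) (hregs : ∀ z ∈ [n, d, b, 1, i, pos, neg], z < 2 ^ B)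
    (hf : ∀ i < d, inp (x₀ + i) = (f i).toNat) (hf' : ∀ i, d ≤ i → f i = false) (hb : x₀ + d ≤ b)
    (hD : ∀ k < D, k * κ < d) (hD' : d ≤ D * κ)
    (hM : ∀ k ≤ D, (leaves F K κ f k).length ≤ M)
    (hkeys : ∀ k ≤ D, ∀ a ∈ leaves F K κ f k, a.1 < 2 ^ B)
    (hend : b + 4 * ((D + 1) * M) < 2 ^ B)
    (hN : ∀ l : List Bool, l.length = κ → (expandNode K (F l)).straightCost ≤ N) :
    ∃ (Q' : ℕ → ℕ) (P j : ℕ), (∀ a, Q' a < 2 ^ B) ∧ Holds Q' P (leaves F K κ f D) ∧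
      P + 2 * (leaves F K κ f D).length = j ∧ b + 2 * j < 2 ^ B ∧
      Exec B (expandRow K κ F) (st inp b Q C (regs n d b x₀ i 0 0 0 0 0 0 0 0 pos neg))
        (st inp b Q' C (regs n d b (x₀ + d) i (b + 2 * P) (b + 2 * j) 0 0 0 0 0 0 pos neg))
        (expandRowCost κ N D M) := by
  have hregs' := hregs
  simp only [List.mem_cons, List.not_mem_nil, or_false, forall_eq_or_imp, forall_eq] at hregs'
  have hstart : Exec B startQueue _ _ _ := straight_startQueue.exec_eval
    (bounded_st (b := b) (l := regs n d b x₀ i 0 0 0 0 0 0 0 0 pos neg) hinp hQ hC (by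
      simp only [List.mem_cons, List.not_mem_nil, or_false, forall_eq_or_imp, forall_eq]
      omega)) eval_startQueue
  have hmono : ∀ k ≤ D, (k + 1) * M ≤ (D + 1) * M := fun k hk => Nat.mul_le_mul_right _ (by omega)
  obtain ⟨s', hs', Q', P, hQ', hA, hP, rfl⟩ := Exec.loop_invariant
    (B := B) (i := 8) (p := expandLevel K κ F) (N := D) (c := κ * branchCost + M * (N + 1) + 10)
    (fun k s => ∃ (Q' : ℕ → ℕ) (P : ℕ), (∀ a, Q' a < 2 ^ B) ∧ Holds Q' P (leaves F K κ f k) ∧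
      -- Within a row the queue only grows: each level adds at most `M` nodes of two entries.
      -- Entries are two cells apart, whence the factor 4 in `hend`.
      P + 2 * (leaves F K κ f k).length ≤ 2 * ((k + 1) * M) ∧
      s = st inp b Q' C (regs n d b (x₀ + min (k * κ) d) i (b + 2 * P)
        (b + 2 * (P + 2 * (leaves F K κ f k).length)) (d - k * κ) 0 0 0 0 0 pos neg))
    (by
      rintro _ ⟨Q', P, -, -, -, rfl⟩
      exact Nat.sub_eq_zero_of_le hD')
    (by
      rintro k hk _ ⟨Q', P, hQ', hA, hP, rfl⟩
      have hk1 := hM (k + 1) hk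
      have hk0 := hM k hk.le
      have hkD := hmono (k + 1) hk
      have e : (k + 1 + 1) * M = (k + 1) * M + M := Nat.succ_mul _ _
      have hkκ := hD k hk
      refine ⟨?_, ?_, _, (exec_expandLevel (f := f) (N := N) (A' := leaves F K κ f (k + 1))
        hinp hQ' hC hregs hf hf' hb hA rfl rfl ?_ (hkeys _ hk) (hN _ (length_revBits _ _))).mono ?_,
        _, P + 2 * (leaves F K κ f k).length, writeNodes_lt hQ' (hkeys _ hk) hregs'.2.2.2.1, holds_writeNodes _ _ _, ?_, ?_⟩
      · exact Nat.sub_ne_zero_of_lt hkκ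
      · exact (Nat.sub_le _ _).trans_lt hregs'.2.1
      · omega
      · gcongr
      · omega
      · rw [Nat.succ_mul k κ])
    (s := st inp b (writeNodes Q 0 [(0, false)]) C
      (regs n d b x₀ i b (b + 2 * 2) d 0 0 0 0 0 pos neg))
    (by
      have := hM 0 (Nat.zero_le _)
      simp only [leaves, List.length_cons, List.length_nil] at this
      refine ⟨_, 0, writeNodes_lt hQ (hkeys 0 (Nat.zero_le _)) hregs'.2.2.2.1,
        holds_writeNodes _ _ _, ?_, ?_⟩
      · simp only [leaves, List.length_cons, List.length_nil]
        omega
      · simp [leaves])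
  refine ⟨Q', P, _, hQ', hA, rfl, ?_, ?_⟩
  · have := hmono D le_rfl
    omega
  · rw [min_eq_right hD', Nat.sub_eq_zero_of_le hD'] at hs'
    exact hstart.seq hs'

/-! ### The loops over the vectors -/

/-- Process a row: put its leaves into the queue, run the given program for each of them, and
prepare for the next row. -/
def processRow (K κ : ℕ) (F : List Bool → List (ℕ × Bool)) (leaf : Program) : Program :=
  .seq (expandRow K κ F) (.seq (.sub 13 7 6) (.seq (.loop 13 leaf)
    (.seq (.const 6 0) (.seq (.const 7 0) (.sub 5 5 3)))))

/-- A bound on the cost of `processRow`. -/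
def processRowCost (κ N D M c : ℕ) : ℕ := expandRowCost κ N D M + M * (c + 1) + 25

/-- The treatment of the leaves is a hypothesis, so that left and right rows share the proof.
Remains of earlier queues are harmless, hence the final queue is only asserted to be bounded. -/
theorem exec_processRow {B K κ x₀ N D M c pos' neg' : ℕ} {C' : ℕ → ℕ} {f : ℕ → Bool}
    {F : List Bool → List (ℕ × Bool)} {leaf : Program}
    (hinp : ∀ a, inp a < 2 ^ B) (hQ : ∀ a, Q a < 2 ^ B)
    (hC : ∀ a, C a < 2 ^ B) (hC' : ∀ a, C' a < 2 ^ B)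
    (hregs : ∀ z ∈ [n, d, b, 1, i, pos, neg, pos', neg'], z < 2 ^ B)
    (hf : ∀ i < d, inp (x₀ + i) = (f i).toNat) (hf' : ∀ i, d ≤ i → f i = false) (hb : x₀ + d ≤ b)
    (hD : ∀ k < D, k * κ < d) (hD' : d ≤ D * κ)
    (hM : ∀ k ≤ D, (leaves F K κ f k).length ≤ M)
    (hkeys : ∀ k ≤ D, ∀ a ∈ leaves F K κ f k, a.1 < 2 ^ B)
    (hend : b + 4 * ((D + 1) * M) < 2 ^ B)
    (hN : ∀ l : List Bool, l.length = κ → (expandNode K (F l)).straightCost ≤ N)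
    (hleaf : ∀ (Q' : ℕ → ℕ) (P j : ℕ), (∀ a, Q' a < 2 ^ B) → Holds Q' P (leaves F K κ f D) →
      P + 2 * (leaves F K κ f D).length = j → b + 2 * j < 2 ^ B → Exec B (.loop 13 leaf)
        (st inp b Q' C (regs n d b (x₀ + d) i (b + 2 * P) (b + 2 * j) 0 0 0 0 0
          (b + 2 * j - (b + 2 * P)) pos neg))
        (st inp b Q' C' (regs n d b (x₀ + d) i (b + 2 * j) (b + 2 * j) 0 0 0 0 0 0 pos' neg'))
        ((leaves F K κ f D).length * (c + 1) + 1)) :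
    ∃ Q' : ℕ → ℕ, (∀ a, Q' a < 2 ^ B) ∧ Exec B (processRow K κ F leaf)
      (st inp b Q C (regs n d b x₀ i 0 0 0 0 0 0 0 0 pos neg))
      (st inp b Q' C' (regs n d b (x₀ + d) (i - 1) 0 0 0 0 0 0 0 0 pos' neg'))
      (processRowCost κ N D M c) := by
  have hregs' := hregs
  simp only [List.mem_cons, List.not_mem_nil, or_false, forall_eq_or_imp, forall_eq] at hregs'
  obtain ⟨Q', P, j, hQ', hA, hj, hend', h1⟩ := exec_expandRow (n := n) (i := i) (pos := pos)
    (neg := neg) hinp hQ hC (by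
      simp only [List.mem_cons, List.not_mem_nil, or_false, forall_eq_or_imp, forall_eq]
      omega) hf hf' hb hD hD' hM hkeys hend hN
  refine ⟨Q', hQ', ?_⟩
  have h2 : Exec B (.sub 13 7 6) _ _ _ := Program.Straight.exec_eval (p := .sub 13 7 6) trivial
    (bounded_st (b := b) (l := regs n d b (x₀ + d) i (b + 2 * P) (b + 2 * j) 0 0 0 0 0 0 pos neg) hinp hQ' hC
      (by
        simp only [List.mem_cons, List.not_mem_nil, or_false, forall_eq_or_imp, forall_eq]
        omega)) (st_setReg _ (by simp))
  have h3 := hleaf Q' P j hQ' hA hj hend'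
  have hS : (Program.seq (.const 6 0) (.seq (.const 7 0) (.sub 5 5 3))).Straight := by
    simp [Program.Straight]
  have h4 := hS.exec_eval (bounded_st (b := b)
    (l := regs n d b (x₀ + d) i (b + 2 * j) (b + 2 * j) 0 0 0 0 0 0 pos' neg') hinp hQ' hC'
      (by
        simp only [List.mem_cons, List.not_mem_nil, or_false, forall_eq_or_imp, forall_eq]
        omega)) (s' := st inp b Q' C' (regs n d b (x₀ + d) (i - 1) 0 0 0 0 0 0 0 0 pos' neg'))
    (by
      simp only [Program.eval, st_reg, st_setReg, List.getD_cons_succ, List.getD_cons_zero,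
        List.set_cons_succ, List.set_cons_zero, List.length_cons, List.length_nil, Nat.reduceAdd,
        Nat.reduceLT])
  refine (h1.seq (h2.seq (h3.seq h4))).mono ?_
  have e2 : ∀ i j k, (Program.sub i j k).straightCost = 3 := fun _ _ _ => rfl
  have e4 : (Program.seq (.const 6 0) (.seq (.const 7 0) (.sub 5 5 3))).straightCost = 21 := by
    simp [Program.straightCost, Program.weight]
  have := Nat.mul_le_mul_right (c + 1) (hM D le_rfl)
  rw [e2, e4, processRowCost]
  omega

theorem sum_range_le_mul {f : ℕ → ℕ} {m Y : ℕ} (h : ∀ k < m, f k ≤ Y) :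
    ∑ k ∈ Finset.range m, f k ≤ m * Y := by
  simpa using Finset.sum_le_card_nsmul (Finset.range m) f Y fun k hk => h k (Finset.mem_range.1 hk)

theorem list_sum_map_le {α : Type*} {f : α → ℕ} {A : List α} {Y : ℕ} (h : ∀ a, f a ≤ Y) :
    (A.map f).sum ≤ A.length * Y := by
  induction A with
  | nil => simp
  | cons a A ih =>
    simp only [List.map_cons, List.sum_cons, List.length_cons, Nat.succ_mul]
    have := h a
    omega

/-- The number of occurrences of a key in the lists of the first `k` rows. -/
def keyCount (A : ℕ → List (ℕ × Bool)) (k a : ℕ) : ℕ :=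
  ∑ l ∈ Finset.range k, ((A l).map Prod.fst).count a

theorem keyCount_le {A : ℕ → List (ℕ × Bool)} {M : ℕ} (hM : ∀ l, (A l).length ≤ M) (k a : ℕ) :
    keyCount A k a ≤ k * M :=
  sum_range_le_mul fun l _ => List.count_le_length.trans (by simpa using hM l)

/-- The sum, over the keys with positive sign in the first `k` rows, of the weights `C`. -/
def posTotal (C : ℕ → ℕ) (A : ℕ → List (ℕ × Bool)) (k : ℕ) : ℕ :=
  ∑ l ∈ Finset.range k, ((A l).map fun a => if a.2 then 0 else C a.1).sum

/-- The sum, over the keys with negative sign in the first `k` rows, of the weights `C`. -/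
def negTotal (C : ℕ → ℕ) (A : ℕ → List (ℕ × Bool)) (k : ℕ) : ℕ :=
  ∑ l ∈ Finset.range k, ((A l).map fun a => if a.2 then C a.1 else 0).sum

theorem posTotal_le {A : ℕ → List (ℕ × Bool)} {M X : ℕ} (hM : ∀ l, (A l).length ≤ M)
    (hX : ∀ a, C a ≤ X) (k : ℕ) : posTotal C A k ≤ k * (M * X) :=
  sum_range_le_mul fun l _ => (list_sum_map_le (Y := X) fun a => by
    split_ifs <;> simp [hX]).trans (Nat.mul_le_mul_right _ (hM l))

theorem negTotal_le {A : ℕ → List (ℕ × Bool)} {M X : ℕ} (hM : ∀ l, (A l).length ≤ M)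
    (hX : ∀ a, C a ≤ X) (k : ℕ) : negTotal C A k ≤ k * (M * X) :=
  sum_range_le_mul fun l _ => (list_sum_map_le (Y := X) fun a => by
    split_ifs <;> simp [hX]).trans (Nat.mul_le_mul_right _ (hM l))

/-- The rows of bits `f` stand in the input from position `x₀` on, and all numbers that arise when
they are expanded are small. -/
structure RowsFit (B K κ N D M n d b x₀ : ℕ) (inp : ℕ → ℕ) (F : List Bool → List (ℕ × Bool))
    (f : ℕ → ℕ → Bool) : Prop where
  inp_lt : ∀ a, inp a < 2 ^ B
  inp_eq : ∀ k < n, ∀ i < d, inp (x₀ + k * d + i) = (f k i).toNat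
  eq_false : ∀ k i, d ≤ i → f k i = false
  le_base : x₀ + n * d ≤ b
  mul_lt : ∀ k < D, k * κ < d
  le_mul : d ≤ D * κ
  length_le : ∀ l, ∀ k ≤ D, (leaves F K κ (f l) k).length ≤ M
  key_lt : ∀ l, ∀ k ≤ D, ∀ a ∈ leaves F K κ (f l) k, a.1 < 2 ^ B
  queue_lt : b + 4 * ((D + 1) * M) < 2 ^ B
  cost_le : ∀ l : List Bool, l.length = κ → (expandNode K (F l)).straightCost ≤ N
  count_lt : n * M < 2 ^ B
  total_lt : n * (M * (n * M)) < 2 ^ B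
  n_lt : n < 2 ^ B
  d_lt : d < 2 ^ B
  one_lt : 1 < 2 ^ B

variable {B K κ N D M x₀ : ℕ} {F : List Bool → List (ℕ × Bool)} {f : ℕ → ℕ → Bool}

theorem RowsFit.exec_countRows (hR : RowsFit B K κ N D M n d b x₀ inp F f)
    (hQ : ∀ a, Q a < 2 ^ B) :
    ∃ Q' : ℕ → ℕ, (∀ a, Q' a < 2 ^ B) ∧ Exec B (.loop 5 (processRow K κ F countLeaf))
      (st inp b Q (fun _ => 0) (regs n d b x₀ n 0 0 0 0 0 0 0 0 0 0))
      (st inp b Q' (keyCount (fun l => leaves F K κ (f l) D) n)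
        (regs n d b (x₀ + n * d) 0 0 0 0 0 0 0 0 0 0 0))
      (n * (processRowCost κ N D M countLeaf.straightCost + 1) + 1) := by
  have hlen : ∀ l, (leaves F K κ (f l) D).length ≤ M := fun l => hR.length_le l D le_rfl
  have hb : b < 2 ^ B := by have := hR.queue_lt; omega
  have hn := hR.n_lt
  have hd := hR.d_lt
  have h1 := hR.one_lt
  obtain ⟨s', hs', Q', hQ', rfl⟩ := Exec.loop_invariant (B := B) (i := 5)
    (p := processRow K κ F countLeaf) (N := n)
    (c := processRowCost κ N D M countLeaf.straightCost)
    (fun k s => ∃ Q' : ℕ → ℕ, (∀ a, Q' a < 2 ^ B) ∧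
      s = st inp b Q' (keyCount (fun l => leaves F K κ (f l) D) k)
        (regs n d b (x₀ + k * d) (n - k) 0 0 0 0 0 0 0 0 0 0))
    (by
      rintro _ ⟨Q', -, rfl⟩
      exact Nat.sub_self n)
    (by
      rintro k hk _ ⟨Q', hQ', rfl⟩
      have hk1 : (k + 1) * M ≤ n * M := Nat.mul_le_mul_right _ hk
      have hk2 := hR.count_lt
      -- The room `M` is what the increments of one more row may need.
      have hC : ∀ a, keyCount (fun l => leaves F K κ (f l) D) k a + M < 2 ^ B := fun a => by
        have := keyCount_le hlen k a
        rw [Nat.succ_mul] at hk1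
        omega
      have hkd : (k + 1) * d ≤ n * d := Nat.mul_le_mul_right _ hk
      have hbase := hR.le_base
      rw [Nat.succ_mul] at hkd
      have e : (fun a => keyCount (fun l => leaves F K κ (f l) D) k a +
          ((leaves F K κ (f k) D).map Prod.fst).count a) =
          keyCount (fun l => leaves F K κ (f l) D) (k + 1) := by
        funext a
        simp only [keyCount, Finset.sum_range_succ]
      obtain ⟨Q'', hQ'', h⟩ := exec_processRow (n := n) (d := d) (i := n - k) (pos := 0) (neg := 0)
        (pos' := 0) (neg' := 0) (x₀ := x₀ + k * d) (leaf := countLeaf)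
        (C := keyCount (fun l => leaves F K κ (f l) D) k)
        (C' := keyCount (fun l => leaves F K κ (f l) D) (k + 1)) hR.inp_lt hQ'
        (fun a => by have := hC a; omega)
        (fun a => (keyCount_le hlen (k + 1) a).trans_lt (by omega))
        (by
          simp only [List.mem_cons, List.not_mem_nil, or_false, forall_eq_or_imp, forall_eq]
          omega)
        (hR.inp_eq k hk) (hR.eq_false k) (by omega) hR.mul_lt hR.le_mul (hR.length_le k)
        (hR.key_lt k) hR.queue_lt hR.cost_le
        (fun Q₁ P j hQ₁ hA hj hend => by
          rw [← e]
          exact exec_countLeaves hR.inp_lt hQ₁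
            (fun a => by have := hC a; have := hlen k; omega)
            (by
              simp only [List.mem_cons, List.not_mem_nil, or_false, forall_eq_or_imp, forall_eq]
              omega) hA hj)
      refine ⟨Nat.sub_ne_zero_of_lt hk, (Nat.sub_le n k).trans_lt hn, _, h, Q'', hQ'', ?_⟩
      rw [Nat.succ_mul, ← Nat.add_assoc, Nat.sub_sub])
    (s := st inp b Q (fun _ => 0) (regs n d b x₀ n 0 0 0 0 0 0 0 0 0 0))
    ⟨Q, hQ, by rw [Nat.zero_mul]; rfl⟩
  rw [Nat.sub_self] at hs'
  exact ⟨Q', hQ', hs'⟩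

theorem RowsFit.exec_lookupRows (hR : RowsFit B K κ N D M n d b x₀ inp F f)
    (hQ : ∀ a, Q a < 2 ^ B) (hC : ∀ a, C a ≤ n * M) :
    ∃ Q' : ℕ → ℕ, (∀ a, Q' a < 2 ^ B) ∧ Exec B (.loop 5 (processRow K κ F lookupLeaf))
      (st inp b Q C (regs n d b x₀ n 0 0 0 0 0 0 0 0 0 0))
      (st inp b Q' C (regs n d b (x₀ + n * d) 0 0 0 0 0 0 0 0 0
        (posTotal C (fun l => leaves F K κ (f l) D) n)
        (negTotal C (fun l => leaves F K κ (f l) D) n)))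
      (n * (processRowCost κ N D M lookupLeaf.straightCost + 1) + 1) := by
  have hlen : ∀ l, (leaves F K κ (f l) D).length ≤ M := fun l => hR.length_le l D le_rfl
  have hb : b < 2 ^ B := by have := hR.queue_lt; omega
  have hn := hR.n_lt
  have hd := hR.d_lt
  have h1 := hR.one_lt
  have hC' : ∀ a, C a < 2 ^ B := fun a => (hC a).trans_lt hR.count_lt
  obtain ⟨s', hs', Q', hQ', rfl⟩ := Exec.loop_invariant (B := B) (i := 5)
    (p := processRow K κ F lookupLeaf) (N := n)
    (c := processRowCost κ N D M lookupLeaf.straightCost)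
    (fun k s => ∃ Q' : ℕ → ℕ, (∀ a, Q' a < 2 ^ B) ∧
      s = st inp b Q' C (regs n d b (x₀ + k * d) (n - k) 0 0 0 0 0 0 0 0
        (posTotal C (fun l => leaves F K κ (f l) D) k)
        (negTotal C (fun l => leaves F K κ (f l) D) k)))
    (by
      rintro _ ⟨Q', -, rfl⟩
      exact Nat.sub_self n)
    (by
      rintro k hk _ ⟨Q', hQ', rfl⟩
      have hk1 : (k + 1) * (M * (n * M)) ≤ n * (M * (n * M)) := Nat.mul_le_mul_right _ hk
      have hk2 := hR.total_lt
      have hpos := posTotal_le hlen hC k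
      have hneg := negTotal_le hlen hC k
      have hpos' := posTotal_le hlen hC (k + 1)
      have hneg' := negTotal_le hlen hC (k + 1)
      have hlk := Nat.mul_le_mul_right (n * M) (hlen k)
      rw [Nat.succ_mul] at hk1
      rw [Nat.succ_mul] at hpos' hneg'
      have hkd : (k + 1) * d ≤ n * d := Nat.mul_le_mul_right _ hk
      have hbase := hR.le_base
      rw [Nat.succ_mul] at hkd
      obtain ⟨Q'', hQ'', h⟩ := exec_processRow (n := n) (d := d) (i := n - k)
        (pos := posTotal C (fun l => leaves F K κ (f l) D) k)
        (neg := negTotal C (fun l => leaves F K κ (f l) D) k)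
        (pos' := posTotal C (fun l => leaves F K κ (f l) D) (k + 1))
        (neg' := negTotal C (fun l => leaves F K κ (f l) D) (k + 1))
        (x₀ := x₀ + k * d) (leaf := lookupLeaf) (C := C) (C' := C) hR.inp_lt hQ' hC' hC'
        (by
          simp only [List.mem_cons, List.not_mem_nil, or_false, forall_eq_or_imp, forall_eq]
          omega)
        (hR.inp_eq k hk) (hR.eq_false k) (by omega) hR.mul_lt hR.le_mul (hR.length_le k)
        (hR.key_lt k) hR.queue_lt hR.cost_le
        (fun Q₁ P j hQ₁ hA hj hend => by
          have := exec_lookupLeaves (b := b) (n := n) (d := d) (x := x₀ + k * d + d) (i := n - k) (r := 0)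
            (pos := posTotal C (fun l => leaves F K κ (f l) D) k)
            (neg := negTotal C (fun l => leaves F K κ (f l) D) k) hR.inp_lt hQ₁ hC' hC
            (by omega) (by omega)
            (by
              simp only [List.mem_cons, List.not_mem_nil, or_false, forall_eq_or_imp, forall_eq]
              omega) hA hj
          simpa only [posTotal, negTotal, Finset.sum_range_succ] using this)
      refine ⟨Nat.sub_ne_zero_of_lt hk, (Nat.sub_le n k).trans_lt hn, _, h, Q'', hQ'', ?_⟩
      rw [Nat.succ_mul, ← Nat.add_assoc, Nat.sub_sub])
    (s := st inp b Q C (regs n d b x₀ n 0 0 0 0 0 0 0 0 0 0))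
    ⟨Q, hQ, by rw [Nat.zero_mul]; rfl⟩
  rw [Nat.sub_self] at hs'
  exact ⟨Q', hQ', hs'⟩

/-! ### The whole program -/

/-- Put twice the product of the registers `0` and `1` into register `2`, using register `5`. -/
def computeBase : Program :=
  .seq (.add 5 0 13) (.loop 5 (.seq (.add 2 2 1) (.seq (.add 2 2 1) (.sub 5 5 3))))

/-- The program that counts orthogonal vectors by means of a factorization with left keys `F`, right
keys `G` and inner dimension `K` of the disjointness matrix of `κ` bits. -/
def countProgram (K κ : ℕ) (F G : List Bool → List (ℕ × Bool)) : Program :=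
  .seq (.const 3 1) (.seq computeBase
    (.seq (.seq (.add 5 0 13) (.loop 5 (processRow K κ F countLeaf)))
      (.seq (.seq (.add 5 0 13) (.loop 5 (processRow K κ G lookupLeaf))) (.sub 0 14 15))))

/-- Without a multiplication instruction the base is obtained by adding `d` twice in each of `n`
rounds, which is within the linear budget. -/
theorem exec_computeBase (hinp : ∀ a, inp a < 2 ^ B) (hn : n < 2 ^ B) (hd : d < 2 ^ B)
    (hone : 1 < 2 ^ B) (hbase : 2 * (n * d) < 2 ^ B) :
    Exec B computeBase (st inp b (fun _ => 0) (fun _ => 0) (regs n d 0 0 0 0 0 0 0 0 0 0 0 0 0))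
      (st inp b (fun _ => 0) (fun _ => 0) (regs n d (2 * (n * d)) 0 0 0 0 0 0 0 0 0 0 0 0))
      (n * 22 + 4) := by
  have hB : ∀ y z, y < 2 ^ B → z < 2 ^ B →
      Bounded B (st inp b (fun _ => 0) (fun _ => 0) (regs n d y 0 z 0 0 0 0 0 0 0 0 0 0)) := by
    intro y z _ _
    refine bounded_st hinp (by intro; positivity) (by intro; positivity) ?_
    simp only [List.mem_cons, List.not_mem_nil, or_false, forall_eq_or_imp, forall_eq]
    omega
  have h1 : Exec B (.add 5 0 13) _ _ _ := Program.Straight.exec_eval (p := .add 5 0 13) trivial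
    (hB 0 0 (by omega) (by omega)) (st_setReg _ (by simp))
  obtain ⟨s', hs', rfl⟩ := Exec.loop_invariant (B := B) (i := 5)
    (p := .seq (.add 2 2 1) (.seq (.add 2 2 1) (.sub 5 5 3))) (N := n) (c := 21)
    (fun k s => s = st inp b (fun _ => 0) (fun _ => 0)
      (regs n d (2 * (k * d)) 0 (n - k) 0 0 0 0 0 0 0 0 0 0))
    (by
      rintro _ rfl
      exact Nat.sub_self n)
    (by
      rintro k hk _ rfl
      refine ⟨Nat.sub_ne_zero_of_lt hk, (Nat.sub_le n k).trans_lt hn, _,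
        (Program.Straight.exec_eval ?_ (hB _ _ ?_ ?_) ?_).mono le_rfl, rfl⟩
      · simp [Program.Straight]
      · have : k * d ≤ n * d := Nat.mul_le_mul_right _ hk.le
        omega
      · omega
      · simp only [Program.eval, st_reg, st_setReg, List.getD_cons_succ, List.getD_cons_zero,
          List.set_cons_succ, List.set_cons_zero, List.length_cons, List.length_nil,
          Nat.reduceAdd, Nat.reduceLT]
        rw [show 2 * (k * d) + d + d = 2 * ((k + 1) * d) by ring, Nat.sub_sub])
    (s := st inp b (fun _ => 0) (fun _ => 0) (regs n d 0 0 n 0 0 0 0 0 0 0 0 0 0))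
    (by rw [Nat.zero_mul]; rfl)
  rw [Nat.sub_self] at hs'
  have e : (Program.add 5 0 13).straightCost = 3 := rfl
  exact (h1.seq hs').mono (by rw [e]; omega)

/-- A bound on the cost of `countProgram`. -/
def countProgramCost (κ N D M n : ℕ) : ℕ :=
  n * (processRowCost κ N D M countLeaf.straightCost +
    processRowCost κ N D M lookupLeaf.straightCost + 24) + 30

theorem exec_countProgram {F G : List Bool → List (ℕ × Bool)} {f g : ℕ → ℕ → Bool}
    (hF : RowsFit B K κ N D M n d (2 * (n * d)) 0 inp F f)
    (hG : RowsFit B K κ N D M n d (2 * (n * d)) (n * d) inp G g) :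
    ∃ s : State, s.reg 0 =
      posTotal (keyCount (fun l => leaves F K κ (f l) D) n) (fun l => leaves G K κ (g l) D) n -
      negTotal (keyCount (fun l => leaves F K κ (f l) D) n) (fun l => leaves G K κ (g l) D) n ∧
      Exec B (countProgram K κ F G) (st inp (2 * (n * d)) (fun _ => 0) (fun _ => 0)
          [n, d, 0, 0, 0, 0, 0, 0, 0, 0, 0, 0, 0, 0, 0, 0]) s
        (countProgramCost κ N D M n) := by
  set A := fun l => leaves F K κ (f l) D
  set A' := fun l => leaves G K κ (g l) D
  have hn := hF.n_lt
  have hd := hF.d_lt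
  have hone := hF.one_lt
  have hbase : 2 * (n * d) < 2 ^ B := by have := hF.queue_lt; omega
  have h0 : ∀ a : ℕ, (fun _ => 0 : ℕ → ℕ) a < 2 ^ B := by intro; positivity
  have hC : ∀ a, keyCount A n a ≤ n * M := keyCount_le (fun l => hF.length_le l D le_rfl) n
  have hC' : ∀ a, keyCount A n a < 2 ^ B := fun a => (hC a).trans_lt hF.count_lt
  have h1 : Exec B (.const 3 1) _ _ _ := Program.Straight.exec_eval (p := .const 3 1) trivial
    (bounded_st (b := 2 * (n * d)) (l := [n, d, 0, 0, 0, 0, 0, 0, 0, 0, 0, 0, 0, 0, 0, 0])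
      hF.inp_lt h0 h0 (by
        simp only [List.mem_cons, List.not_mem_nil, or_false, forall_eq_or_imp, forall_eq]
        omega)) (st_setReg _ (by simp))
  have h2 := exec_computeBase (b := 2 * (n * d)) hF.inp_lt hn hd hone hbase
  have h3 : Exec B (.add 5 0 13) _ _ _ := Program.Straight.exec_eval (p := .add 5 0 13) trivial
    (bounded_st (b := 2 * (n * d)) (l := regs n d (2 * (n * d)) 0 0 0 0 0 0 0 0 0 0 0 0)
      hF.inp_lt h0 h0 (by
        simp only [List.mem_cons, List.not_mem_nil, or_false, forall_eq_or_imp, forall_eq]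
        omega)) (st_setReg _ (by simp))
  obtain ⟨Q₁, hQ₁, h4⟩ := hF.exec_countRows h0
  rw [Nat.zero_add] at h4
  have h5 : Exec B (.add 5 0 13) _ _ _ := Program.Straight.exec_eval (p := .add 5 0 13) trivial
    (bounded_st (b := 2 * (n * d)) (l := regs n d (2 * (n * d)) (n * d) 0 0 0 0 0 0 0 0 0 0 0)
      hF.inp_lt hQ₁ hC' (by
        simp only [List.mem_cons, List.not_mem_nil, or_false, forall_eq_or_imp, forall_eq]
        omega)) (st_setReg _ (by simp))
  obtain ⟨Q₂, hQ₂, h6⟩ := hG.exec_lookupRows hQ₁ hC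
  have hpos : posTotal (keyCount A n) A' n < 2 ^ B :=
    (posTotal_le (fun l => hG.length_le l D le_rfl) hC n).trans_lt hF.total_lt
  have hneg : negTotal (keyCount A n) A' n < 2 ^ B :=
    (negTotal_le (fun l => hG.length_le l D le_rfl) hC n).trans_lt hF.total_lt
  have h7 : Exec B (.sub 0 14 15) _ _ _ := Program.Straight.exec_eval (p := .sub 0 14 15) trivial
    (bounded_st (b := 2 * (n * d)) (l := regs n d (2 * (n * d)) (n * d + n * d) 0 0 0 0 0 0 0 0 0
      (posTotal (keyCount A n) A' n) (negTotal (keyCount A n) A' n)) hF.inp_lt hQ₂ hC' (by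
        simp only [List.mem_cons, List.not_mem_nil, or_false, forall_eq_or_imp, forall_eq]
        omega)) (st_setReg _ (by simp))
  refine ⟨_, ?_, (h1.seq (h2.seq ((h3.seq h4).seq ((h5.seq h6).seq h7)))).mono ?_⟩
  · rfl
  · have e1 : ∀ i j k, (Program.add i j k).straightCost = 3 := fun _ _ _ => rfl
    have e2 : ∀ i j k, (Program.sub i j k).straightCost = 3 := fun _ _ _ => rfl
    have e3 : ∀ i, (Program.const i 1).straightCost = 10 := fun _ => by
      simp [Program.straightCost, Program.weight]
    rw [e1, e2, e3, countProgramCost]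
    ring_nf
    omega

/-! ### Correctness of the count -/

/-- Exchanging the two sums shows that the left list matters only through the multiplicities of its
keys, which is why a single table can serve all left rows at once. -/
theorem pairing_eq_sum_count (A A' : List (ℕ × Bool)) :
    pairing A A' = (A'.map fun a => bitSign a.2 * ((A.map Prod.fst).count a.1 : ℤ)).sum := by
  induction A with
  | nil => simp [pairing]
  | cons c A ih =>
    rw [pairing_cons, ih, ← List.sum_map_add]
    refine congrArg List.sum (List.map_congr_left fun a _ => ?_)
    rw [List.map_cons, List.count_cons]
    by_cases h : c.1 = a.1
    · simp [h]; ring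
    · simp [h]

theorem list_sum_map_finset_sum {α : Type*} (A : List α) (s : Finset ℕ) (φ : ℕ → α → ℤ) :
    (A.map fun a => ∑ l ∈ s, φ l a).sum = ∑ l ∈ s, (A.map (φ l)).sum := by
  induction A with
  | nil => simp
  | cons a A ih => simp [ih, Finset.sum_add_distrib]

/-- The machine has no negative numbers, so the signed sum is kept as two totals. Pairing is
additive in the left list, so the table of all rows accounts for all pairs. -/
theorem posTotal_sub_negTotal (A A' : ℕ → List (ℕ × Bool)) (m k : ℕ) :
    (posTotal (keyCount A m) A' k : ℤ) - negTotal (keyCount A m) A' k =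
      ∑ j ∈ Finset.range k, ∑ l ∈ Finset.range m, pairing (A l) (A' j) := by
  have h : ∀ (C : ℕ → ℕ) (L : List (ℕ × Bool)),
      (((L.map fun a => if a.2 then 0 else C a.1).sum : ℕ) : ℤ) -
        ((L.map fun a => if a.2 then C a.1 else 0).sum : ℕ) =
          (L.map fun a => bitSign a.2 * (C a.1 : ℤ)).sum := by
    intro C L
    induction L with
    | nil => simp
    | cons a L ih =>
      simp only [List.map_cons, List.sum_cons, ← ih, Nat.cast_add]
      cases a.2 <;> simp only [bitSign, Bool.false_eq_true, if_false, if_true, Nat.cast_zero] <;> ring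
  simp only [posTotal, negTotal, Nat.cast_sum, ← Finset.sum_sub_distrib, h]
  simp only [keyCount, Nat.cast_sum, Finset.mul_sum, pairing_eq_sum_count, list_sum_map_finset_sum]

/-! ### The input as rows of bits -/

/-- The rows of a table of bits, continued by zeros. -/
def rowBits (u : Fin n → Fin d → Bool) (l i : ℕ) : Bool :=
  if h : l < n ∧ i < d then u ⟨l, h.1⟩ ⟨i, h.2⟩ else false

theorem rowBits_fin (u : Fin n → Fin d → Bool) (l : Fin n) (i : Fin d) :
    rowBits u l i = u l i := by
  simp [rowBits]

theorem rowBits_of_le (u : Fin n → Fin d → Bool) (l i : ℕ) (h : d ≤ i) : rowBits u l i = false := by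
  simp [rowBits, h.not_gt]

theorem entry_eq_rowBits (u : Fin n → Fin d → Bool) {k i : ℕ} (hk : k < n) (hi : i < d) :
    entry u (k * d + i) = (rowBits u k i).toNat := by
  have h : k * d + i < n * d := by
    have := Nat.mul_le_mul_right d (Nat.succ_le_of_lt hk)
    rw [Nat.succ_mul] at this
    omega
  have e1 : (k * d + i) / d = k := by
    rw [Nat.add_comm, Nat.add_mul_div_right _ _ (by omega), Nat.div_eq_of_lt hi, Nat.zero_add]
  have e2 : (k * d + i) % d = i := by
    rw [Nat.add_comm, Nat.add_mul_mod_self_right, Nat.mod_eq_of_lt hi]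
  simp only [entry, h, dif_pos, rowBits, hk, hi, and_self, e1, e2]

/-- Any `m` not below `d` will do, since rows are padded with zeros; it is applied with `d` rounded
up to a multiple of `κ`. -/
theorem count_eq_sum (u v : Fin n → Fin d → Bool) {m : ℕ} (hm : d ≤ m) :
    (count u v : ℤ) = ∑ j ∈ Finset.range n, ∑ l ∈ Finset.range n,
      if ∀ i < m, ¬ (rowBits u l i = true ∧ rowBits v j i = true) then 1 else 0 := by
  rw [Finset.sum_comm, count, Finset.card_filter, Nat.cast_sum, ← Finset.univ_product_univ,
    Finset.sum_product, Finset.sum_range]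
  refine Finset.sum_congr rfl fun l _ => ?_
  rw [Finset.sum_range]
  refine Finset.sum_congr rfl fun j _ => ?_
  rw [Nat.cast_ite, Nat.cast_one, Nat.cast_zero]
  refine if_congr ?_ rfl rfl
  rw [Finset.sum_eq_zero_iff_of_nonneg fun _ _ => by positivity]
  constructor
  · intro h i _ hi
    rcases Nat.lt_or_ge i d with hd | hd
    · have := h ⟨i, hd⟩ (Finset.mem_univ _)
      rw [rowBits_fin u l ⟨i, hd⟩, rowBits_fin v j ⟨i, hd⟩] at hi
      simp [hi.1, hi.2] at this
    · rw [rowBits_of_le u _ _ hd] at hi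
      exact Bool.false_ne_true hi.1
  · intro h i _
    have := h i (i.2.trans_le hm)
    rw [rowBits_fin, rowBits_fin] at this
    cases hu : u l i <;> cases hv : v j i <;> simp_all

theorem input_eq_st (u v : Fin n → Fin d → Bool) :
    input u v = st (input u v).mem (2 * (n * d)) (fun _ => 0) (fun _ => 0)
      [n, d, 0, 0, 0, 0, 0, 0, 0, 0, 0, 0, 0, 0, 0, 0] := by
  simp only [st, input, State.mk.injEq]
  constructor
  · funext i
    rcases i with _ | _ | i
    · rfl
    · rfl
    · rw [if_neg (by omega), if_neg (by omega)]
      simp only [List.getD_cons_succ]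
      rcases Nat.lt_or_ge i 14 with hi | hi
      · interval_cases i <;> rfl
      · rw [List.getD_eq_default _ _ (by simpa using hi)]
  · funext a
    simp only [layout, ite_self]
    split_ifs with h1 h2
    · rfl
    · omega
    · rfl
    · rw [entry, dif_neg (by omega)]

theorem input_mem_le (u v : Fin n → Fin d → Bool) (a : ℕ) : (input u v).mem a ≤ 1 := by
  have h : ∀ (u : Fin n → Fin d → Bool) (a : ℕ), entry u a ≤ 1 := by
    intro u a
    rw [entry]
    split_ifs
    · exact Bool.toNat_le _
    · exact Nat.zero_le _
  simp only [input]
  split_ifs <;> exact h _ _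

theorem row_add_lt {k i : ℕ} (hk : k < n) (hi : i < d) : k * d + i < n * d := by
  have := Nat.mul_le_mul_right d (Nat.succ_le_of_lt hk)
  rw [Nat.succ_mul] at this
  omega

theorem input_mem_left (u v : Fin n → Fin d → Bool) {k i : ℕ} (hk : k < n) (hi : i < d) :
    (input u v).mem (0 + k * d + i) = (rowBits u k i).toNat := by
  simp only [input, Nat.zero_add, row_add_lt hk hi, if_true, entry_eq_rowBits u hk hi]

theorem input_mem_right (u v : Fin n → Fin d → Bool) {k i : ℕ} (hk : k < n) (hi : i < d) :
    (input u v).mem (n * d + k * d + i) = (rowBits v k i).toNat := by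
  simp only [input]
  rw [if_neg (by omega), Nat.add_assoc, Nat.add_sub_cancel_left, entry_eq_rowBits v hk hi]

/-! ### Choice of the parameters and the asymptotic bound -/

/-- The number of blocks of `κ` bits in a row of `d` bits. -/
def numBlocks (κ d : ℕ) : ℕ := (d + κ - 1) / κ

theorem numBlocks_mul_le (κ d : ℕ) : numBlocks κ d * κ ≤ d + κ - 1 := Nat.div_mul_le_self _ _

theorem le_numBlocks_mul {κ : ℕ} (hκ : 1 ≤ κ) (d : ℕ) : d ≤ numBlocks κ d * κ := by
  have h1 := Nat.div_add_mod (d + κ - 1) κ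
  have h2 := Nat.mod_lt (d + κ - 1) hκ
  rw [numBlocks, Nat.mul_comm]
  omega

theorem mul_lt_of_lt_numBlocks {κ k d : ℕ} (hκ : 1 ≤ κ) (hk : k < numBlocks κ d) : k * κ < d := by
  have h1 := numBlocks_mul_le κ d
  have h2 := Nat.mul_le_mul_right κ (Nat.succ_le_of_lt hk)
  rw [Nat.succ_mul] at h2
  omega

theorem numBlocks_le {κ : ℕ} (hκ : 1 ≤ κ) (d : ℕ) : numBlocks κ d ≤ d := by
  by_contra! h
  have h1 := mul_lt_of_lt_numBlocks hκ h
  have h2 := Nat.mul_le_mul_left d hκ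
  omega

/-- A number of bits that suffices for all numbers in the computation. -/
def wordSize (K L n d : ℕ) : ℕ := 2 * n.size + (2 * L + K + 2) * d + 4

/-- The word size enters the running time only as a logarithmic factor, so crude estimates such as
`K ^ D ≤ 2 ^ (K * d)` suffice. The largest number is a total of at most `n ^ 2 * M ^ 2`. -/
theorem rowsFit {κ K L N x₀ : ℕ} {F : List Bool → List (ℕ × Bool)} {f : ℕ → ℕ → Bool}
    (hκ : 1 ≤ κ) (hL : 1 ≤ L) (hlen : ∀ x, x.length = κ → (F x).length ≤ L)
    (hK : ∀ x, ∀ k ∈ F x, k.1 < K)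
    (hN : ∀ l : List Bool, l.length = κ → (expandNode K (F l)).straightCost ≤ N)
    (hinp : ∀ a, inp a ≤ 1) (hf : ∀ k < n, ∀ i < d, inp (x₀ + k * d + i) = (f k i).toNat)
    (hf' : ∀ k i, d ≤ i → f k i = false) (hx : x₀ ≤ n * d) :
    RowsFit (wordSize K L n d) K κ N (numBlocks κ d) (L ^ numBlocks κ d) n d (2 * (n * d)) x₀ inp F
      f := by
  set E := 2 * n.size + (2 * L + K + 2) * d with hE
  set D := numBlocks κ d
  have hDd : D ≤ d := numBlocks_le hκ d
  -- The four extra bits leave a factor 16 for sums such as the last queue address, which is at most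
  -- `6 * 2 ^ E`.
  have hB : 2 ^ wordSize K L n d = 16 * 2 ^ E := by rw [wordSize, ← hE, pow_add]; ring
  have hE1 : 1 ≤ 2 ^ E := Nat.one_le_two_pow
  have hle : ∀ m, m ≤ E → 2 ^ m ≤ 2 ^ E := fun m hm => Nat.pow_le_pow_right (by norm_num) hm
  have hn : n ≤ 2 ^ n.size := (Nat.lt_size_self n).le
  have hd : d ≤ 2 ^ d := Nat.lt_two_pow_self.le
  have hd1 : D + 1 ≤ 2 ^ d := (Nat.succ_le_succ hDd).trans Nat.lt_two_pow_self
  have hM : L ^ D ≤ 2 ^ (L * d) := by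
    rw [pow_mul]
    exact (Nat.pow_le_pow_left Nat.lt_two_pow_self.le D).trans
      (Nat.pow_le_pow_right (by positivity) hDd)
  have hnM : n * L ^ D ≤ 2 ^ (n.size + L * d) := by rw [pow_add]; exact Nat.mul_le_mul hn hM
  have hEe : E = 2 * n.size + (2 * (L * d) + K * d + 2 * d) := by rw [hE]; ring
  constructor
  · intro a
    have := hinp a
    omega
  · exact hf
  · exact hf'
  · omega
  · exact fun k hk => mul_lt_of_lt_numBlocks hκ hk
  · exact le_numBlocks_mul hκ d
  · exact fun l k hk => (length_leaves_le hlen _ _).trans (Nat.pow_le_pow_right hL hk)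
  · intro l k hk a ha
    have h1 := leaves_lt hK (f l) k a ha
    have h2 : K ^ k ≤ 2 ^ (K * d) := by
      rw [pow_mul]
      exact (Nat.pow_le_pow_left Nat.lt_two_pow_self.le k).trans
        (Nat.pow_le_pow_right (by positivity) (hk.trans hDd))
    have h3 := hle (K * d) (by omega)
    omega
  · have h1 : n * d ≤ 2 ^ (n.size + d) := by rw [pow_add]; exact Nat.mul_le_mul hn hd
    have h2 : (D + 1) * L ^ D ≤ 2 ^ (d + L * d) := by rw [pow_add]; exact Nat.mul_le_mul hd1 hM
    have h3 := hle (n.size + d) (by omega)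
    have h4 := hle (d + L * d) (by omega)
    omega
  · exact hN
  · have := hle (n.size + L * d) (by omega)
    omega
  · have h1 : n * (L ^ D * (n * L ^ D)) ≤ 2 ^ (n.size + L * d + (n.size + L * d)) := by
      rw [← Nat.mul_assoc, pow_add]
      exact Nat.mul_le_mul hnM hnM
    have h2 := hle (n.size + L * d + (n.size + L * d)) (by omega)
    omega
  · have := hle n.size (by omega)
    omega
  · have := hle d (by omega)
    omega
  · omega

theorem exists_bound_of_length_eq (κ : ℕ) (G : List Bool → ℕ) :
    ∃ N, ∀ l : List Bool, l.length = κ → G l ≤ N := by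
  obtain ⟨N, hN⟩ := ((List.finite_length_eq Bool κ).image G).bddAbove
  exact ⟨N, fun l hl => hN ⟨l, hl, rfl⟩⟩

/-- Per row there are `D` levels with at most `M` nodes each, followed by a pass over the leaves; `D
+ 1` keeps the bound positive when `d = 0`. -/
theorem exists_countProgramCost_le (κ N : ℕ) : ∃ c : ℕ, ∀ D M n : ℕ, 1 ≤ M → 1 ≤ n →
    countProgramCost κ N D M n ≤ c * (n * ((D + 1) * M)) := by
  have h : ∀ c : ℕ, ∃ c' : ℕ, ∀ D M : ℕ, 1 ≤ M →
      processRowCost κ N D M c ≤ c' * ((D + 1) * M) := by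
    intro c
    refine ⟨startQueue.straightCost + 1 + 25 + (κ * branchCost + 11) + (N + 1) + (c + 1),
      fun D M hM => ?_⟩
    have h1 : D ≤ (D + 1) * M := by nlinarith
    have h2 : 1 ≤ (D + 1) * M := by nlinarith
    have h3 : D * M ≤ (D + 1) * M := Nat.mul_le_mul_right _ (Nat.le_succ D)
    have h4 : M ≤ (D + 1) * M := by nlinarith
    have h5 := Nat.mul_le_mul_left (κ * branchCost + 11) h1
    have h6 := Nat.mul_le_mul_left (N + 1) h3
    have h7 := Nat.mul_le_mul_left (c + 1) h4
    have h8 := Nat.mul_le_mul_left (startQueue.straightCost + 1 + 25) h2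
    have e : processRowCost κ N D M c = (startQueue.straightCost + 1 + 25) * 1 +
        (κ * branchCost + 11) * D + (N + 1) * (D * M) + (c + 1) * M := by
      rw [processRowCost, expandRowCost]; ring
    rw [e]
    exact (Nat.add_le_add (Nat.add_le_add (Nat.add_le_add h8 h5) h6) h7).trans
      (le_of_eq (by ring))
  obtain ⟨c₁, h₁⟩ := h countLeaf.straightCost
  obtain ⟨c₂, h₂⟩ := h lookupLeaf.straightCost
  refine ⟨c₁ + c₂ + 24 + 30, fun D M n hM hn => ?_⟩
  have hT : 1 ≤ (D + 1) * M := by nlinarith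
  have hnT : 1 ≤ n * ((D + 1) * M) := Nat.mul_pos hn hT
  have h3 := Nat.mul_le_mul_left n (Nat.add_le_add (h₁ D M hM) (h₂ D M hM))
  have h4 := Nat.mul_le_mul_left n hT
  rw [countProgramCost]
  nlinarith

theorem exec_countProgram_input {κ K L N : ℕ} (Φ : Factorization κ K L) (hκ : 1 ≤ κ) (hL : 1 ≤ L)
    (hl : ∀ l : List Bool, l.length = κ → (expandNode K (Φ.left l)).straightCost ≤ N)
    (hr : ∀ l : List Bool, l.length = κ → (expandNode K (Φ.right l)).straightCost ≤ N)
    (u v : Fin n → Fin d → Bool) :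
    ∃ s : State, s.reg 0 = count u v ∧
      Exec (wordSize K L n d) (countProgram K κ Φ.left Φ.right) (input u v) s
        (countProgramCost κ N (numBlocks κ d) (L ^ numBlocks κ d) n) := by
  obtain ⟨s, hs, hrun⟩ := exec_countProgram
    (rowsFit (inp := (input u v).mem) (f := rowBits u) hκ hL Φ.length_left Φ.left_lt hl
      (input_mem_le u v) (fun k hk i hi => input_mem_left u v hk hi) (rowBits_of_le u)
      (Nat.zero_le _))
    (rowsFit (inp := (input u v).mem) (f := rowBits v) hκ hL Φ.length_right Φ.right_lt hr
      (input_mem_le u v) (fun k hk i hi => input_mem_right u v hk hi) (rowBits_of_le v) le_rfl)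
  rw [← input_eq_st] at hrun
  refine ⟨s, ?_, hrun⟩
  have h := posTotal_sub_negTotal (fun l => leaves Φ.left K κ (rowBits u l) (numBlocks κ d))
    (fun l => leaves Φ.right K κ (rowBits v l) (numBlocks κ d)) n n
  simp only [Φ.pairing_leaves] at h
  rw [← count_eq_sum u v (le_numBlocks_mul hκ d)] at h
  rw [hs]
  -- The truncated subtraction of the totals is exact because the difference equals the nonnegative
  -- count.
  omega

theorem size_le_log {n : ℕ} (hn : 1 ≤ n) : (n.size : ℝ) ≤ 1 + 2 * Real.log n := by
  have h1 : 2 ^ (n.size - 1) ≤ n := by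
    rw [← Nat.lt_size]
    have := Nat.size_pos.2 hn
    omega
  have h2 : (2 : ℝ) ^ (n.size - 1) ≤ n := by exact_mod_cast h1
  have h3 := Real.log_le_log (by positivity) h2
  rw [Real.log_pow] at h3
  have h4 := Real.log_two_gt_d9
  have h5 : (n.size : ℝ) = ((n.size - 1 : ℕ) : ℝ) + 1 := by
    have := Nat.size_pos.2 hn
    rw [← Nat.cast_add_one]
    congr 1; omega
  have h6 : (0 : ℝ) ≤ ((n.size - 1 : ℕ) : ℝ) := Nat.cast_nonneg _
  nlinarith

/-- With `Λ` the logarithmic factor, both the number of levels and the word size are `O(Λ)`, which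
gives the exponent 2. Rounding `d` up to a multiple of `κ` costs at most the constant factor `1.26 ^
κ`. -/
theorem cost_bound {κ K L c n d : ℕ} (hκ : 1 ≤ κ) (hL : (L : ℝ) ≤ 1.26 ^ κ) (hn : 1 ≤ n) :
    ((c * (n * ((numBlocks κ d + 1) * L ^ numBlocks κ d)) * (2 * wordSize K L n d + 1) : ℕ) : ℝ) ≤
      (c * (6 * 2 ^ κ * (17 + 10 * (2 * L + K + 2))) : ℕ) * (n * (1.26 : ℝ) ^ d) *
        (1 + Real.log (n * (1.26 : ℝ) ^ d)) ^ 2 := by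
  have hn' : (1 : ℝ) ≤ n := by exact_mod_cast hn
  set D := numBlocks κ d with hD
  set Λ := 1 + Real.log (n * (1.26 : ℝ) ^ d) with hΛ
  have e : Λ = 1 + Real.log n + d * Real.log 1.26 := by
    rw [hΛ, Real.log_mul (by positivity) (by positivity), Real.log_pow, add_assoc]
  -- From `log x ≥ 1 - 1 / x`, which is about 0.206 here. It makes `d` itself at most `5 * Λ`.
  have h1 : (1 / 5 : ℝ) ≤ Real.log 1.26 :=
    le_trans (by norm_num) (Real.one_sub_inv_le_log_of_pos (show (0 : ℝ) < 1.26 by norm_num))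
  have h2 := Real.log_nonneg hn'
  have h3 := size_le_log hn
  have h4 : (0 : ℝ) ≤ d := Nat.cast_nonneg d
  have h5 : (d : ℝ) * (1 / 5) ≤ d * Real.log 1.26 := mul_le_mul_of_nonneg_left h1 h4
  have hΛ1 : 1 ≤ Λ := by rw [e]; nlinarith
  have hd : (d : ℝ) ≤ 5 * Λ := by rw [e]; nlinarith
  have hσ : (n.size : ℝ) ≤ 2 * Λ := by rw [e]; nlinarith
  have hD1 : ((D + 1 : ℕ) : ℝ) ≤ 6 * Λ := by
    have : ((D + 1 : ℕ) : ℝ) ≤ d + 1 := by exact_mod_cast Nat.succ_le_succ (numBlocks_le hκ d)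
    linarith
  have hB : ((2 * wordSize K L n d + 1 : ℕ) : ℝ) ≤ (17 + 10 * (2 * L + K + 2)) * Λ := by
    rw [wordSize]
    push_cast
    have : (2 * (L : ℝ) + K + 2) * d ≤ (2 * L + K + 2) * (5 * Λ) :=
      mul_le_mul_of_nonneg_left hd (by positivity)
    nlinarith
  have hM : (L : ℝ) ^ D ≤ 2 ^ κ * 1.26 ^ d := by
    calc (L : ℝ) ^ D ≤ (1.26 ^ κ) ^ D := by gcongr
      _ = 1.26 ^ (D * κ) := by rw [← pow_mul, mul_comm]
      _ ≤ 1.26 ^ (κ + d) := pow_le_pow_right₀ (by norm_num) (by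
          have := numBlocks_mul_le κ d
          rw [← hD] at this
          omega)
      _ = 1.26 ^ κ * 1.26 ^ d := pow_add _ _ _
      -- The constant has to be a natural number, hence the passage from `1.26 ^ κ` to `2 ^ κ`.
      _ ≤ 2 ^ κ * 1.26 ^ d := by gcongr; norm_num
  calc ((c * (n * ((D + 1) * L ^ D)) * (2 * wordSize K L n d + 1) : ℕ) : ℝ)
      = c * (n * (((D + 1 : ℕ) : ℝ) * (L : ℝ) ^ D)) * ((2 * wordSize K L n d + 1 : ℕ) : ℝ) := by
        push_cast; ring
    _ ≤ c * (n * ((6 * Λ) * (2 ^ κ * 1.26 ^ d))) * ((17 + 10 * (2 * L + K + 2)) * Λ) := by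
        gcongr
    _ = _ := by push_cast; ring

end OrthogonalVectors

theorem mainTheorem7 :
    ∃ (P : RAM.Program) (C k : ℕ),
      ∀ (n d : ℕ), 1 ≤ n → ∀ u v : Fin n → Fin d → Bool,
        ∃ (s : RAM.State) (t : ℕ),
          RAM.Runs P (OrthogonalVectors.input u v) s t ∧
          s.reg 0 = OrthogonalVectors.count u v ∧
          (t : ℝ) ≤ C * (n * (1.26 : ℝ) ^ d) * (1 + Real.log (n * (1.26 : ℝ) ^ d)) ^ k := by
  obtain ⟨κ, K, L, hκ, hL, hLκ, ⟨Φ⟩⟩ := OrthogonalVectors.exists_factorization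
  -- There are finitely many strings of `κ` bits; the sum of the two costs gives one bound for both
  -- sides.
  obtain ⟨N, hN⟩ := OrthogonalVectors.exists_bound_of_length_eq κ fun l =>
    (OrthogonalVectors.expandNode K (Φ.left l)).straightCost +
      (OrthogonalVectors.expandNode K (Φ.right l)).straightCost
  obtain ⟨c, hc⟩ := OrthogonalVectors.exists_countProgramCost_le κ N
  refine ⟨OrthogonalVectors.countProgram K κ Φ.left Φ.right,
    c * (6 * 2 ^ κ * (17 + 10 * (2 * L + K + 2))), 2, fun n d hn u v => ?_⟩
  obtain ⟨s, hs, t, hrun, ht⟩ := OrthogonalVectors.exec_countProgram_input Φ hκ hL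
    (fun l hl => (Nat.le_add_right _ _).trans (hN l hl))
    (fun l hl => (Nat.le_add_left _ _).trans (hN l hl)) u v
  refine ⟨s, t, hrun, hs, le_trans ?_ (OrthogonalVectors.cost_bound (K := K) hκ hLκ hn)⟩
  exact_mod_cast ht.trans (Nat.mul_le_mul_right _ (hc _ _ n (Nat.one_le_pow _ _ hL) hn))
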